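/- **Setting.** Let $M$ be a factorizable monoid with group of units $W$ and set of idempotents $E(M)$, i.e. $M=E(M)W=WE(M)$ and idempotents commute; idempotents are ordered by $e\le f\iff ef=fe=e$. Then $M$ is an inverse monoid; $r^*$ denotes the unique element with $rr^*r=r$, $r^*rr^*=r^*$. Let $(W,S)$ be a Coxeter system and $\Lambda\subseteq E(M)$ a transversal of $E(M)$ for conjugation by $W$, closed under products. For $I\subseteq S$ let $W_I=\langle I\rangle$. Suppose that $(M,\Lambda,S)$ is a generalized Renner–Coxeter system, that is: for all $e\le e'$ in $E(M)$ there are $w\in W$ and $f\le f'$ in $\Lambda$ with $wew^{-1}=f$, $we'w^{-1}=f'$; with $\lambda^*(e)=\{s\in S: se=es\ne e\}$, one has $\lambda^*(e)\subseteq\lambda^*(f)$ for $e\le f$ in $\Lambda$; and for each $e\in\Lambda$ the groups $\{w\in W: we=ew\}$ and $\{w\in W: we=ew=e\}$ are of the form $W_{\lambda(e)}$ and $W_{\lambda_*(e)}$ with $\lambda(e),\lambda_*(e)\subseteq S$. No finiteness is assumed. Let $\le$ be the Bruhat order on $W$, and ${}^IW^J=\{u\in W: u\le v\ \text{for all } v\in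 W_IuW_J\}$, ${}^IW={}^IW^{\emptyset}$, $W^J={}^{\emptyset}W^J$. Every $r\in M$ has a unique left standard form $r=xey$ ($e\in\Lambda$, $x\in W^{\lambda_*(e)}$, $y\in{}^{\lambda(e)}W$), a unique right standard form $r=yex$ ($e\in\Lambda$, $x\in{}^{\lambda_*(e)}W$, $y\in W^{\lambda(e)}$), and a unique hybrid standard form $r=aebec$ ($e\in\Lambda$, $a\in W^{\lambda(e)}$, $b\in W_{\lambda^*(e)}$, $c\in{}^{\lambda(e)}W$). For $r=xey$, $s=afb$ in left standard form, $r\le^+s$ means: $e\le f$ and there is $w\in W_{\lambda^*(f)}W_{\lambda_*(e)}$ with $x\le aw$ and $w^{-1}b\le y$. For $r=yex$, $s=bfa$ in right standard form, $r\le^-s$ means: $e\le f$ and there is $w\in W_{\lambda_*(e)}W_{\lambda^*(f)}$ with $x\le wa$ and $bw^{-1}\le y$. Let $\mathcal L,\mathcal R,\mathcal H$ be Green's relations ($r\,\mathcal L\,s\iff Mr=Ms$; $r\,\mathcal R\,s\iff rM=sM$; $\mathcal H=\mathcal L\cap\mathcal R$), with classes $L_r,R_r,H_r$. Let - $\mathcal{GJ}^+$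 be the set of $r$ with $x=1$ in the left standard form $r=xey$, - $\mathcal{JG}^-$ the set of $r$ with $x=1$ in the right standard form $r=yex$, - $\mathcal O$ the set of $r$ with $b=1$ in the hybrid standard form $r=aebec$. **Theorem.** 1. $\mathcal{GJ}^+=\{r:\forall s\in L_r,\ r\le^+s\}$, $\mathcal{JG}^-=\{r:\forall s\in R_r,\ r\le^-s\}$, and $\mathcal O=\{r:\forall s\in H_r,\ r\le^+s\}=\{r:\forall s\in H_r,\ r\le^-s\}$. 2. $(\mathcal{GJ}^+)^*=\mathcal{JG}^-$ and $\mathcal O^*=\mathcal O$. 3. $\mathcal{GJ}^+$, $\mathcal{JG}^-$ and $\mathcal O$ are submonoids of $M$. 4. $\mathcal O$ is the smallest submonoid of $M$ containing $\mathcal{GJ}^+$ and $\mathcal{JG}^-$; the smallest inverse submonoid containing $\mathcal{GJ}^+$; and the smallest inverse submonoid containing $\mathcal{JG}^-$. 5. $E(M)\subseteq\mathcal O$. 6. If $r\le^+s$, $a\in\mathcal{GJ}^+\cap L_r$ and $b\in\mathcal{GJ}^+\cap L_s$, then $a\le^+b$. 7. If $r\le^-s$, $a\in\mathcal{JG}^-\cap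 R_r$ and $b\in\mathcal{JG}^-\cap R_s$, then $a\le^-b$. 8. The maps $r\mapsto L_r$ and $r\mapsto R_r$ are bijections $\mathcal{GJ}^+\to M/\mathcal L$ and $\mathcal{JG}^-\to M/\mathcal R$: every $\mathcal L$-class contains exactly one element of $\mathcal{GJ}^+$, every $\mathcal R$-class exactly one element of $\mathcal{JG}^-$. 9. The map $r\mapsto H_r$ is a bijection $\mathcal O\to M/\mathcal H$. -/

import Mathlib

namespace RennerCoxeter

universe u v

/-! ## Coxeter groups: Bruhat order, parabolic subgroups, minimal coset representatives -/

section Coxeter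

variable {B : Type v} {M : CoxeterMatrix B} {W : Type u} [Group W]

/-- The Bruhat order: some reduced word of `u` is a subword of some reduced word of `w`. -/
def BruhatLE (cs : CoxeterSystem M W) (u w : W) : Prop :=
  ∃ ω ω' : List B, cs.IsReduced ω ∧ cs.wordProd ω = w ∧
    cs.IsReduced ω' ∧ cs.wordProd ω' = u ∧ List.Sublist ω' ω

/-- The standard parabolic subgroup `W_I`; a set of simple reflections is given by its set `I`
of indices. -/
def parabolic (cs : CoxeterSystem M W) (I : Set B) : Subgroup W :=
  Subgroup.closure (cs.simple '' I)

/-- The set `^I W ^J` of those `w` that are the Bruhat minimum of their double coset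
`W_I w W_J`. -/
def minReps (cs : CoxeterSystem M W) (I J : Set B) : Set W :=
  {w | ∀ a ∈ parabolic cs I, ∀ b ∈ parabolic cs J, BruhatLE cs w (a * w * b)}

/-- `W^J = ^∅ W ^J`. -/
def rightMin (cs : CoxeterSystem M W) (J : Set B) : Set W := minReps cs ∅ J

/-- `^I W = ^I W ^∅`. -/
def leftMin (cs : CoxeterSystem M W) (I : Set B) : Set W := minReps cs I ∅

end Coxeter

/-! ## Factorizable monoids and inverse monoids -/

section Monoids

/-- `n` is an inverse of `r` in the sense of semigroup theory. -/
def IsInverseOf {R : Type u} [Monoid R] (n r : R) : Prop := r * n * r = r ∧ n * r * n = n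

/-- An inverse monoid: each element has exactly one inverse. -/
def IsInverseMonoid (R : Type u) [Monoid R] : Prop := ∀ r : R, ∃! n : R, IsInverseOf n r

/-- A factorizable monoid: `R = E(R) G(R) = G(R) E(R)`, and the idempotents commute (so that
`E(R)` is a meet semilattice with meet `e * f` for the order `e ≤ f ↔ e f = f e = e`). -/
structure IsFactorizable (R : Type u) [Monoid R] : Prop where
  idem_mul_unit : ∀ r : R, ∃ e : R, IsIdempotentElem e ∧ ∃ w : Rˣ, r = e * w
  unit_mul_idem : ∀ r : R, ∃ w : Rˣ, ∃ e : R, IsIdempotentElem e ∧ r = w * e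
  idem_comm : ∀ e f : R, IsIdempotentElem e → IsIdempotentElem f → e * f = f * e

/-- Factorizable monoids are inverse monoids, so `r ↦ r*` makes sense on them. -/
theorem IsFactorizable.isInverseMonoid {R : Type u} [Monoid R] (h : IsFactorizable R) :
    IsInverseMonoid R := by
  intro r
  have uniq : ∀ n n' : R, IsInverseOf n r → IsInverseOf n' r → n = n' * r * n := by
    rintro n n' ⟨h1, h2⟩ ⟨h3, -⟩
    have i1 : IsIdempotentElem (n * r) := by
      unfold IsIdempotentElem; rw [← mul_assoc, h2]
    have i2 : IsIdempotentElem (n' * r) := by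
      unfold IsIdempotentElem; rw [mul_assoc, ← mul_assoc r, h3]
    calc n = n * r * n := h2.symm
      _ = n * (r * n' * r) * n := by rw [h3]
      _ = (n * r) * (n' * r) * n := by simp only [mul_assoc]
      _ = (n' * r) * (n * r) * n := by rw [h.idem_comm _ _ i1 i2]
      _ = n' * r * (n * r * n) := by simp only [mul_assoc]
      _ = n' * r * n := by rw [h2]
  have uniq' : ∀ n n' : R, IsInverseOf n r → IsInverseOf n' r → n' = n' * r * n := by
    rintro n n' ⟨h1, h2⟩ ⟨h3, h4⟩
    have i1 : IsIdempotentElem (r * n) := by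
      unfold IsIdempotentElem; rw [← mul_assoc, h1]
    have i2 : IsIdempotentElem (r * n') := by
      unfold IsIdempotentElem; rw [← mul_assoc, h3]
    calc n' = n' * r * n' := h4.symm
      _ = n' * (r * n * r) * n' := by rw [h1]
      _ = n' * ((r * n) * (r * n')) := by simp only [mul_assoc]
      _ = n' * ((r * n') * (r * n)) := by rw [h.idem_comm _ _ i1 i2]
      _ = (n' * r * n') * r * n := by simp only [mul_assoc]
      _ = n' * r * n := by rw [h4]
  obtain ⟨e, he, w, rfl⟩ := h.idem_mul_unit r
  refine ⟨((w⁻¹ : Rˣ) : R) * e, ⟨?_, ?_⟩, fun n' hn' => ?_⟩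
  · have : e * w * (((w⁻¹ : Rˣ) : R) * e) = e := by
      rw [mul_assoc, Units.mul_inv_cancel_left, he.eq]
    rw [this, ← mul_assoc, he.eq]
  · have : e * w * (((w⁻¹ : Rˣ) : R) * e) = e := by
      rw [mul_assoc, Units.mul_inv_cancel_left, he.eq]
    rw [mul_assoc, this, mul_assoc, he.eq]
  · have hn : IsInverseOf (((w⁻¹ : Rˣ) : R) * e) (e * w) := by
      have : e * w * (((w⁻¹ : Rˣ) : R) * e) = e := by
        rw [mul_assoc, Units.mul_inv_cancel_left, he.eq]
      exact ⟨by rw [this, ← mul_assoc, he.eq], by rw [mul_assoc, this, mul_assoc, he.eq]⟩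
    exact (uniq' _ _ hn hn').trans (uniq _ _ hn hn').symm

/-- The inverse `r*` of `r` in an inverse monoid. -/
noncomputable def invStar {R : Type u} [Monoid R] (h : IsInverseMonoid R) (r : R) : R :=
  (h r).choose

/-- The order `e ≤ f ↔ e f = f e = e` on idempotents. -/
def IdemLE {R : Type u} [Monoid R] (e f : R) : Prop := e * f = e ∧ f * e = e

/-- Green's relation `L`: `R r = R s`. -/
def greenL (R : Type u) [Monoid R] : Setoid R :=
  Setoid.ker fun r : R => Set.range fun t : R => t * r

/-- Green's relation `R`: `r R = s R`. -/
def greenR (R : Type u) [Monoid R] : Setoid R :=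
  Setoid.ker fun r : R => Set.range fun t : R => r * t

/-- Green's relation `H`: `r L s` and `r R s`. -/
def greenH (R : Type u) [Monoid R] : Setoid R := greenL R ⊓ greenR R

end Monoids

/-! ## Generalized Renner-Coxeter systems -/

section Systems

variable {R : Type u} [Monoid R] {B : Type v} {M : CoxeterMatrix B}

/-- The type map `λ(e) = {s ∈ S | s e = e s}`. -/
def typeMap (cs : CoxeterSystem M Rˣ) (e : R) : Set B :=
  {i | (cs.simple i : R) * e = e * cs.simple i}

/-- The lower type map `λ_*(e) = {s ∈ S | s e = e s = e}`. -/
def lowerType (cs : CoxeterSystem M Rˣ) (e : R) : Set B :=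
  {i | (cs.simple i : R) * e = e ∧ e * cs.simple i = e}

/-- The upper type map `λ^*(e) = {s ∈ S | s e = e s ≠ e}`. -/
def upperType (cs : CoxeterSystem M Rˣ) (e : R) : Set B :=
  {i | (cs.simple i : R) * e = e * cs.simple i ∧ e * cs.simple i ≠ e}

/-- `(R, Λ, S)` is a generalized Renner-Coxeter system, where `S` is the set of simple
reflections of the Coxeter system `cs` on the group of units of `R`. -/
structure IsSystem (cs : CoxeterSystem M Rˣ) (Λ : Set R) : Prop where
  factorizable : IsFactorizable R
  /-- `Λ ⊆ E(R)`. -/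
  idem : ∀ e ∈ Λ, IsIdempotentElem e
  /-- `Λ` is a transversal for the conjugation action of the units on `E(R)`. -/
  transversal : ∀ e : R, IsIdempotentElem e →
    ∃! f : R, f ∈ Λ ∧ ∃ w : Rˣ, (w : R) * e * ((w⁻¹ : Rˣ) : R) = f
  /-- `Λ` is a sub-meet semilattice of `E(R)`. -/
  mul_mem : ∀ e ∈ Λ, ∀ f ∈ Λ, e * f ∈ Λ
  conj_pair : ∀ e e' : R, IsIdempotentElem e → IsIdempotentElem e' → IdemLE e e' →
    ∃ w : Rˣ, ∃ f ∈ Λ, ∃ f' ∈ Λ, IdemLE f f' ∧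
      (w : R) * e * ((w⁻¹ : Rˣ) : R) = f ∧ (w : R) * e' * ((w⁻¹ : Rˣ) : R) = f'
  upperType_mono : ∀ e ∈ Λ, ∀ f ∈ Λ, IdemLE e f → upperType cs e ⊆ upperType cs f
  centralizer_parabolic : ∀ e ∈ Λ, ∃ I : Set B,
    {w : Rˣ | (w : R) * e = e * w} = (parabolic cs I : Set Rˣ)
  fixer_parabolic : ∀ e ∈ Λ, ∃ I : Set B,
    {w : Rˣ | (w : R) * e = e * w ∧ e * w = e} = (parabolic cs I : Set Rˣ)

/-- The type map is the one of the theory: `W_{λ(e)}` is the centralizer of `e`. -/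
theorem IsSystem.mem_parabolic_typeMap {cs : CoxeterSystem M Rˣ} {Λ : Set R}
    (h : IsSystem cs Λ) {e : R} (he : e ∈ Λ) (w : Rˣ) :
    w ∈ parabolic cs (typeMap cs e) ↔ (w : R) * e = e * w := by
  obtain ⟨I, hI⟩ := h.centralizer_parabolic e he
  have key : ∀ v : Rˣ, v ∈ parabolic cs I ↔ (v : R) * e = e * v := fun v =>
    (Set.ext_iff.mp hI v).symm
  have hIt : I ⊆ typeMap cs e := fun i hi =>
    (key _).mp (Subgroup.subset_closure ⟨i, hi, rfl⟩)
  refine ⟨fun hw => (key w).mp ?_, fun hw =>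
    Subgroup.closure_mono (Set.image_mono hIt) ((key w).mpr hw)⟩
  refine (Subgroup.closure_le (parabolic cs I)).mpr ?_ hw
  rintro _ ⟨i, hi, rfl⟩
  exact (key _).mpr hi

/-- The lower type map is the one of the theory: `W_{λ_*(e)}` is `{w | w e = e w = e}`. -/
theorem IsSystem.mem_parabolic_lowerType {cs : CoxeterSystem M Rˣ} {Λ : Set R}
    (h : IsSystem cs Λ) {e : R} (he : e ∈ Λ) (w : Rˣ) :
    w ∈ parabolic cs (lowerType cs e) ↔ (w : R) * e = e * w ∧ e * w = e := by
  obtain ⟨I, hI⟩ := h.fixer_parabolic e he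
  have key : ∀ v : Rˣ, v ∈ parabolic cs I ↔ (v : R) * e = e * v ∧ e * v = e := fun v =>
    (Set.ext_iff.mp hI v).symm
  have hIt : I ⊆ lowerType cs e := fun i hi => by
    have := (key _).mp (Subgroup.subset_closure ⟨i, hi, rfl⟩)
    exact ⟨this.1.trans this.2, this.2⟩
  refine ⟨fun hw => (key w).mp ?_, fun hw =>
    Subgroup.closure_mono (Set.image_mono hIt) ((key w).mpr hw)⟩
  refine (Subgroup.closure_le (parabolic cs I)).mpr ?_ hw
  rintro _ ⟨i, hi, rfl⟩
  exact (key _).mpr ⟨hi.1.trans hi.2.symm, hi.2⟩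

/-- `r = x e y` is the left standard form of `r`. -/
def IsLeftForm (cs : CoxeterSystem M Rˣ) (Λ : Set R) (r : R) (x : Rˣ) (e : R) (y : Rˣ) : Prop :=
  e ∈ Λ ∧ x ∈ rightMin cs (lowerType cs e) ∧ y ∈ leftMin cs (typeMap cs e) ∧ r = x * e * y

/-- `r = y e x` is the right standard form of `r`. -/
def IsRightForm (cs : CoxeterSystem M Rˣ) (Λ : Set R) (r : R) (y : Rˣ) (e : R) (x : Rˣ) : Prop :=
  e ∈ Λ ∧ x ∈ leftMin cs (lowerType cs e) ∧ y ∈ rightMin cs (typeMap cs e) ∧ r = y * e * x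

/-- `r = a e b e c` is the hybrid standard form of `r`. -/
def IsHybridForm (cs : CoxeterSystem M Rˣ) (Λ : Set R) (r : R)
    (a : Rˣ) (e : R) (b c : Rˣ) : Prop :=
  e ∈ Λ ∧ a ∈ rightMin cs (typeMap cs e) ∧ b ∈ parabolic cs (upperType cs e) ∧
    c ∈ leftMin cs (typeMap cs e) ∧ r = a * e * b * e * c

/-- The adherence order `≤⁺`, defined through left standard forms `r = x e y`, `s = a f b`;
the element `w = u * v` runs through `W_{λ^*(f)} W_{λ_*(e)}`. -/
def AdhPlus (cs : CoxeterSystem M Rˣ) (Λ : Set R) (r s : R) : Prop :=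
  ∃ (x : Rˣ) (e : R) (y a : Rˣ) (f : R) (b : Rˣ),
    IsLeftForm cs Λ r x e y ∧ IsLeftForm cs Λ s a f b ∧ IdemLE e f ∧
    ∃ u ∈ parabolic cs (upperType cs f), ∃ v ∈ parabolic cs (lowerType cs e),
      BruhatLE cs x (a * (u * v)) ∧ BruhatLE cs ((u * v)⁻¹ * b) y

/-- The adherence order `≤⁻`, defined through right standard forms `r = y e x`, `s = b f a`;
the element `w = v * u` runs through `W_{λ_*(e)} W_{λ^*(f)}`. -/
def AdhMinus (cs : CoxeterSystem M Rˣ) (Λ : Set R) (r s : R) : Prop :=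
  ∃ (y : Rˣ) (e : R) (x b : Rˣ) (f : R) (a : Rˣ),
    IsRightForm cs Λ r y e x ∧ IsRightForm cs Λ s b f a ∧ IdemLE e f ∧
    ∃ v ∈ parabolic cs (lowerType cs e), ∃ u ∈ parabolic cs (upperType cs f),
      BruhatLE cs x ((v * u) * a) ∧ BruhatLE cs (b * (v * u)⁻¹) y

/-- `GJ⁺`: the elements with `x = 1` in left standard form `x e y`. -/
def GJ (cs : CoxeterSystem M Rˣ) (Λ : Set R) : Set R :=
  {r | ∃ (e : R) (y : Rˣ), IsLeftForm cs Λ r 1 e y}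

/-- `JG⁻`: the elements with `x = 1` in right standard form `y e x`. -/
def JG (cs : CoxeterSystem M Rˣ) (Λ : Set R) : Set R :=
  {r | ∃ (y : Rˣ) (e : R), IsRightForm cs Λ r y e 1}

/-- `O`: the elements with `b = 1` in hybrid standard form `a e b e c`. -/
def OSet (cs : CoxeterSystem M Rˣ) (Λ : Set R) : Set R :=
  {r | ∃ (a : Rˣ) (e : R) (c : Rˣ), IsHybridForm cs Λ r a e 1 c}

end Systems

end RennerCoxeter

namespace RennerCoxeter

section CoxeterGroups

variable {B : Type*} {M : CoxeterMatrix B} {W : Type*} [Group W] (cs : CoxeterSystem M W)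

/-! ### The exchange and deletion conditions -/

/-! For `r = x e y` in left standard form, `r* r = y⁻¹ e y` and `r r* = x e x⁻¹`. Every idempotent
is `y⁻¹ e y` for exactly one `e ∈ Λ` and one minimal `y` (`conj_eq_conj`). So the L-class of `r`
amounts to the pair `(e, y)`, and its H-class to `(e, y)` together with the coset `x W_{λ(e)}`. `GJ`
and `OSet` select the shortest `x`: the identity, or the minimal element of that coset. This gives
the bijections and one half of the description by minima. For the other half, comparing `r` with the
selected element of its class yields `w ∈ W_{λ(e)}` with `w⁻¹ y ≤ y`. Lengths add along minimal
coset representatives, so `w = 1`, and `x` is no longer than the selected one. The involution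
exchanges left and right forms, L and R, and the two orders, which settles `JG` and `≤⁻`.

The substance is closure under products. `OSet` is stable under multiplication by idempotents
(`mul_idempotent_mem_OSet`), because `λ^*` is monotone and `W_{λ_*(f)}` is absorbed by `f`. A
general product reduces to two factors that meet in one idempotent (`mul_mem_OSet`). `GJ` consists
of the `r` in `OSet` with `r r* ∈ Λ`, so its closure amounts to `e · y f y⁻¹ ∈ Λ` (`mul_conj_mem`).
Finally `a e c = (a e)(e c)` shows that `JG` and `GJ` generate `OSet`.

The Coxeter input is exchange, deletion and additivity of lengths. Transitivity of the Bruhat order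
is not needed. -/

open Classical in
/-- The action of a simple reflection on pairs of a group element and a sign: it conjugates the
first component and changes the sign when the first component is the simple reflection itself. -/
noncomputable def signedConj (i : B) : Function.End (W × ZMod 2) := fun p =>
  (cs.simple i * p.1 * cs.simple i, p.2 + if p.1 = cs.simple i then 1 else 0)

open Classical in
-- The sign records how often the reflection `p.1` occurs in the inversion sequence. The word is
-- reversed because the last factor of a product of maps acts first.
theorem prod_signedConj_reverse (ω : List B) (p : W × ZMod 2) :
    (ω.reverse.map (signedConj cs)).prod p =
      ((cs.wordProd ω)⁻¹ * p.1 * cs.wordProd ω, p.2 + ((cs.leftInvSeq ω).count p.1 : ZMod 2)) := by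
  induction ω generalizing p with
  | nil => simp [Function.End.one_def]
  | cons i ω ih =>
    have hcount : (List.map (MulAut.conj (cs.simple i)) (cs.leftInvSeq ω)).count p.1 =
        (cs.leftInvSeq ω).count (cs.simple i * p.1 * cs.simple i) := by
      have : p.1 = MulAut.conj (cs.simple i) (cs.simple i * p.1 * cs.simple i) := by
        simp [MulAut.conj_apply, mul_assoc]
      conv_lhs => rw [this]
      exact List.count_map_of_injective _ _ (MulAut.conj (cs.simple i)).injective _
    rw [List.reverse_cons, List.map_append, List.prod_append]
    change (ω.reverse.map (signedConj cs)).prod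
      (([i].map (signedConj cs)).prod p) = _
    rw [ih]
    simp only [List.map_cons, List.map_nil, List.prod_cons, List.prod_nil, mul_one, signedConj,
      CoxeterSystem.wordProd_cons, CoxeterSystem.leftInvSeq, List.count_cons, hcount]
    ext
    · simp [mul_assoc]
    · by_cases hp : p.1 = cs.simple i
      · simp only [hp, if_true, beq_self_eq_true]
        push_cast
        ring
      · simp [hp, Ne.symm hp]

theorem prod_map_alternatingWord_reverse {G : Type*} [Monoid G] (f : B → G) (i j : B) (m : ℕ) :
    (((CoxeterSystem.alternatingWord i j (2 * m)).reverse).map f).prod = (f j * f i) ^ m := by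
  induction m with
  | zero => simp [CoxeterSystem.alternatingWord]
  | succ m ih =>
    rw [show 2 * (m + 1) = 2 * m + 1 + 1 by ring, CoxeterSystem.alternatingWord_succ,
      CoxeterSystem.alternatingWord_succ]
    simp only [List.concat_eq_append, List.reverse_append, List.reverse_cons, List.reverse_nil,
      List.nil_append, List.cons_append, List.map_cons, List.prod_cons, ih, pow_succ', mul_assoc]

open Classical in
-- The entry at position `k` is an alternating product of length `2k + 1`. Since the braid relation
-- kills the `M i j`-th power, the second half of the sequence repeats the first.
theorem even_count_leftInvSeq_alternatingWord (i j : B) (t : W) :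
    Even ((cs.leftInvSeq (CoxeterSystem.alternatingWord i j (2 * M i j))).count t) := by
  set L := cs.leftInvSeq (CoxeterSystem.alternatingWord i j (2 * M i j)) with hL
  have hlen : L.length = 2 * M i j := by simp [hL]
  have hdrop : L.drop (M i j) = L.take (M i j) := by
    apply List.ext_getElem
    · simp [hlen]; omega
    · intro k h1 h2
      have hk : k < M i j := by simp at h2; omega
      rw [List.getElem_drop, List.getElem_take]
      simp only [hL]
      rw [CoxeterSystem.getElem_leftInvSeq_alternatingWord cs i j _ _ (by omega),
        CoxeterSystem.getElem_leftInvSeq_alternatingWord cs i j _ _ (by omega),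
        CoxeterSystem.prod_alternatingWord_eq_mul_pow,
        CoxeterSystem.prod_alternatingWord_eq_mul_pow]
      have e1 : (2 * (M i j + k) + 1) / 2 = M i j + k := by omega
      have e2 : (2 * k + 1) / 2 = k := by omega
      have o1 : ¬ Even (2 * (M i j + k) + 1) := by simp
      have o2 : ¬ Even (2 * k + 1) := by simp
      rw [e1, e2, if_neg o1, if_neg o2, pow_add]
      simp
  rw [← List.take_append_drop (M i j) L, List.count_append, hdrop]
  exact ⟨_, rfl⟩

open Classical in
theorem isLiftable_signedConj : M.IsLiftable (signedConj cs) := by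
  intro i j
  rw [M.symmetric i j, ← prod_map_alternatingWord_reverse]
  funext p
  rw [prod_signedConj_reverse]
  have h1 : cs.wordProd (CoxeterSystem.alternatingWord j i (2 * M j i)) = 1 := by
    rw [CoxeterSystem.prod_alternatingWord_eq_mul_pow]
    simp
  have h2 : ((cs.leftInvSeq (CoxeterSystem.alternatingWord j i (2 * M j i))).count p.1 : ZMod 2)
      = 0 := by
    obtain ⟨c, hc⟩ := even_count_leftInvSeq_alternatingWord cs j i p.1
    rw [ZMod.natCast_eq_zero_iff]
    exact ⟨c, by omega⟩
  ext <;> simp [h1, h2, Function.End.one_def]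

open Classical in
/-- The parity of the number of occurrences of `t` in a left inversion sequence depends only on
the group element. -/
theorem count_leftInvSeq_congr {ω ω' : List B} (h : cs.wordProd ω = cs.wordProd ω') (t : W) :
    ((cs.leftInvSeq ω).count t : ZMod 2) = (cs.leftInvSeq ω').count t := by
  have key : ∀ ω : List B, (ω.reverse.map (signedConj cs)).prod =
      cs.lift ⟨signedConj cs, isLiftable_signedConj cs⟩ (cs.wordProd ω)⁻¹ := by
    intro ω
    rw [← CoxeterSystem.wordProd_reverse, CoxeterSystem.wordProd, map_list_prod, List.map_map]
    congr 1
    refine List.map_congr_left fun i _ => ?_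
    simp
  have h1 := prod_signedConj_reverse cs ω (t, 0)
  have h2 := prod_signedConj_reverse cs ω' (t, 0)
  rw [key, h, ← key, h2] at h1
  simpa using (congrArg Prod.snd h1).symm

/-- The exchange condition, for words that need not be reduced. -/
theorem exists_eraseIdx_of_length_lt {i : B} {ω : List B}
    (h : cs.length (cs.simple i * cs.wordProd ω) < cs.length (cs.wordProd ω)) :
    ∃ j < ω.length, cs.simple i * cs.wordProd ω = cs.wordProd (ω.eraseIdx j) := by
  classical
  obtain ⟨τ, hτ, hτw⟩ := cs.exists_isReduced (cs.simple i * cs.wordProd ω)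
  have hprod : cs.wordProd (i :: τ) = cs.wordProd ω := by
    rw [CoxeterSystem.wordProd_cons, ← hτw, CoxeterSystem.simple_mul_simple_cancel_left]
  have hred : cs.IsReduced (i :: τ) := by
    have h2 := hτ.eq
    have h3 := cs.length_simple_mul (cs.wordProd ω) i
    rw [← hτw] at h2
    rw [CoxeterSystem.IsReduced, hprod, List.length_cons]
    omega
  -- The inversion sequence of a reduced word has no repetitions and starts here with `s_i`. The
  -- count is therefore odd, for this word and for every other word with the same product.
  have hone : (cs.leftInvSeq (i :: τ)).count (cs.simple i) = 1 :=
    List.count_eq_one_of_mem hred.nodup_leftInvSeq (by simp [CoxeterSystem.leftInvSeq])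
  have hc := count_leftInvSeq_congr cs hprod (cs.simple i)
  rw [hone] at hc
  have hmem : cs.simple i ∈ cs.leftInvSeq ω := by
    by_contra hn
    rw [List.count_eq_zero_of_not_mem hn] at hc
    simp at hc
  obtain ⟨j, hj, hji⟩ := List.getElem_of_mem hmem
  have hj' : j < ω.length := by simpa using hj
  refine ⟨j, hj', ?_⟩
  rw [← CoxeterSystem.getD_leftInvSeq_mul_wordProd, List.getD_eq_getElem _ _ hj, hji]

/-- The deletion condition: every word has a reduced subword with the same product. -/
theorem exists_reduced_sublist (ω : List B) :
    ∃ ω' : List B, ω'.Sublist ω ∧ cs.IsReduced ω' ∧ cs.wordProd ω' = cs.wordProd ω := by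
  induction ω with
  | nil => exact ⟨[], List.Sublist.refl _, by simp [CoxeterSystem.IsReduced], rfl⟩
  | cons i ω ih =>
    obtain ⟨τ, hsub, hred, hprod⟩ := ih
    rcases cs.length_simple_mul (cs.wordProd τ) i with hl | hl
    · refine ⟨i :: τ, hsub.cons_cons i, ?_, ?_⟩
      · rw [CoxeterSystem.IsReduced, CoxeterSystem.wordProd_cons, hl, hred.eq, List.length_cons]
      · rw [CoxeterSystem.wordProd_cons, CoxeterSystem.wordProd_cons, hprod]
    · obtain ⟨j, hj, he⟩ := exists_eraseIdx_of_length_lt cs (i := i) (ω := τ) (by omega)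
      refine ⟨τ.eraseIdx j, ((List.eraseIdx_sublist _ _).trans hsub).cons i, ?_, ?_⟩
      · have h2 := hred.eq
        rw [CoxeterSystem.IsReduced, ← he, List.length_eraseIdx_of_lt hj]
        omega
      · rw [← he, CoxeterSystem.wordProd_cons, hprod]

/-- If `y` is a suffix of a reduced decomposition of `x`, then every word for `x` has a subword
for `y`. -/
theorem exists_sublist_of_length_add {y : W} (β : List B) {ω : List B}
    (hω : cs.wordProd ω = cs.wordProd β * y)
    (hl : cs.length (cs.wordProd β * y) = β.length + cs.length y) :
    ∃ ω' : List B, ω'.Sublist ω ∧ cs.wordProd ω' = y := by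
  induction β generalizing ω with
  | nil => exact ⟨ω, List.Sublist.refl _, by simpa using hω⟩
  | cons i β ih =>
    rw [CoxeterSystem.wordProd_cons, mul_assoc] at hω hl
    rw [List.length_cons] at hl
    have h1 := cs.length_mul_le (cs.wordProd β) y
    have h2 := cs.length_wordProd_le β
    have h3 := cs.length_simple_mul (cs.wordProd β * y) i
    have hs : cs.simple i * cs.wordProd ω = cs.wordProd β * y := by
      rw [hω, CoxeterSystem.simple_mul_simple_cancel_left]
    -- Additivity of lengths makes `i` a left descent of the product of `ω`, so exchange removes one
    -- letter of `ω` for each letter of `β`.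
    obtain ⟨j, -, he⟩ := exists_eraseIdx_of_length_lt cs (i := i) (ω := ω) (by
      rw [hs, hω]; omega)
    obtain ⟨ω', hsub, hp⟩ := ih (ω := ω.eraseIdx j) (by rw [← he, hs]) (by omega)
    exact ⟨ω', hsub.trans (List.eraseIdx_sublist _ _), hp⟩

/-! ### Parabolic subgroups and minimal coset representatives -/

variable {cs}

theorem simple_mem_parabolic {I : Set B} {i : B} (hi : i ∈ I) : cs.simple i ∈ parabolic cs I :=
  Subgroup.subset_closure ⟨i, hi, rfl⟩

theorem parabolic_mono {I J : Set B} (h : I ⊆ J) : parabolic cs I ≤ parabolic cs J :=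
  Subgroup.closure_mono (Set.image_mono h)

theorem wordProd_mem_parabolic {I : Set B} {ω : List B} (h : ∀ i ∈ ω, i ∈ I) :
    cs.wordProd ω ∈ parabolic cs I := by
  refine Subgroup.list_prod_mem _ fun x hx => ?_
  obtain ⟨i, hi, rfl⟩ := List.mem_map.mp hx
  exact simple_mem_parabolic (h i hi)

theorem exists_word_of_mem_parabolic {I : Set B} {w : W} (hw : w ∈ parabolic cs I) :
    ∃ ω : List B, (∀ i ∈ ω, i ∈ I) ∧ cs.wordProd ω = w := by
  induction hw using Subgroup.closure_induction with
  | mem x hx =>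
    obtain ⟨i, hi, rfl⟩ := hx
    exact ⟨[i], by simpa using hi, by simp⟩
  | one => exact ⟨[], by simp, by simp⟩
  | mul x y _ _ hx hy =>
    obtain ⟨ω, h1, rfl⟩ := hx
    obtain ⟨τ, h2, rfl⟩ := hy
    refine ⟨ω ++ τ, fun i hi => ?_, by rw [CoxeterSystem.wordProd_append]⟩
    exact (List.mem_append.mp hi).elim (h1 i) (h2 i)
  | inv x _ hx =>
    obtain ⟨ω, h1, rfl⟩ := hx
    exact ⟨ω.reverse, fun i hi => h1 i (List.mem_reverse.mp hi), by simp⟩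

theorem exists_reduced_word_of_mem_parabolic {I : Set B} {w : W} (hw : w ∈ parabolic cs I) :
    ∃ ω : List B, (∀ i ∈ ω, i ∈ I) ∧ cs.IsReduced ω ∧ cs.wordProd ω = w := by
  obtain ⟨ω, hI, rfl⟩ := exists_word_of_mem_parabolic hw
  obtain ⟨ω', hsub, hred, hp⟩ := exists_reduced_sublist cs ω
  exact ⟨ω', fun i hi => hI i (hsub.subset hi), hred, hp⟩

theorem parabolic_empty : parabolic cs ∅ = ⊥ := by
  simp [parabolic]

theorem BruhatLE.length_le {u w : W} (h : BruhatLE cs u w) : cs.length u ≤ cs.length w := by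
  obtain ⟨ω, ω', h1, rfl, h2, rfl, hs⟩ := h
  rw [h1.eq, h2.eq]
  exact hs.length_le

theorem BruhatLE.refl (w : W) : BruhatLE cs w w := by
  obtain ⟨ω, h, rfl⟩ := cs.exists_isReduced w
  exact ⟨ω, ω, h, rfl, h, rfl, List.Sublist.refl _⟩

theorem BruhatLE.one_le (w : W) : BruhatLE cs 1 w := by
  obtain ⟨ω, h, rfl⟩ := cs.exists_isReduced w
  exact ⟨ω, [], h, rfl, by simp [CoxeterSystem.IsReduced], by simp, List.nil_sublist _⟩

theorem BruhatLE.inv {u w : W} (h : BruhatLE cs u w) : BruhatLE cs u⁻¹ w⁻¹ := by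
  obtain ⟨ω, ω', h1, rfl, h2, rfl, hs⟩ := h
  exact ⟨ω.reverse, ω'.reverse, h1.reverse, by simp, h2.reverse, by simp, hs.reverse⟩

theorem BruhatLE.of_length_mul {b w : W} (h : cs.length (b * w) = cs.length b + cs.length w) :
    BruhatLE cs w (b * w) := by
  obtain ⟨β, hβ, rfl⟩ := cs.exists_isReduced b
  obtain ⟨ω, hω, rfl⟩ := cs.exists_isReduced w
  refine ⟨β ++ ω, ω, ?_, by rw [CoxeterSystem.wordProd_append], hω, rfl,
    List.sublist_append_right _ _⟩
  rw [CoxeterSystem.IsReduced, CoxeterSystem.wordProd_append, h, hβ.eq, hω.eq, List.length_append]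

theorem mem_leftMin_iff_bruhatLE {J : Set B} {w : W} :
    w ∈ leftMin cs J ↔ ∀ b ∈ parabolic cs J, BruhatLE cs w (b * w) := by
  constructor
  · intro h b hb
    simpa using h b hb 1 (one_mem _)
  · intro h b hb c hc
    rw [parabolic_empty, Subgroup.mem_bot] at hc
    simpa [hc] using h b hb

theorem mem_rightMin_iff {J : Set B} {w : W} : w ∈ rightMin cs J ↔ w⁻¹ ∈ leftMin cs J := by
  rw [mem_leftMin_iff_bruhatLE]
  constructor
  · intro h b hb
    have := (h 1 (one_mem _) b⁻¹ (inv_mem hb)).inv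
    simpa using this
  · intro h c hc b hb
    rw [parabolic_empty, Subgroup.mem_bot] at hc
    have := (h b⁻¹ (inv_mem hb)).inv
    simpa [hc] using this

/-- Every coset of a parabolic subgroup has a representative for which lengths add. -/
theorem exists_parabolic_mul (J : Set B) (w : W) :
    ∃ b ∈ parabolic cs J, ∃ w' : W, w = b * w' ∧
      ∀ c ∈ parabolic cs J, cs.length (c * w') = cs.length c + cs.length w' := by
  obtain ⟨w', ⟨b, hb, rfl⟩, hmin⟩ := exists_minimalFor_of_wellFoundedLT
    (fun v => ∃ b ∈ parabolic cs J, b * w = v) cs.length ⟨w, 1, one_mem _, one_mul _⟩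
  refine ⟨b⁻¹, inv_mem hb, b * w, by simp, fun c hc => ?_⟩
  have hmin' : ∀ d ∈ parabolic cs J, cs.length (b * w) ≤ cs.length (d * (b * w)) := by
    intro d hd
    by_contra hlt
    exact hlt (hmin ⟨d * b, mul_mem hd hb, by rw [mul_assoc]⟩ (by omega))
  generalize b * w = v at hmin' ⊢
  obtain ⟨γ, hγJ, hγ, rfl⟩ := exists_reduced_word_of_mem_parabolic hc
  obtain ⟨ω, hω, rfl⟩ := cs.exists_isReduced v
  obtain ⟨τ, hsub, hred, hp⟩ := exists_reduced_sublist cs (γ ++ ω)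
  obtain ⟨τ₁, τ₂, rfl, hs1, hs2⟩ := List.sublist_append_iff.mp hsub
  rw [CoxeterSystem.wordProd_append, CoxeterSystem.wordProd_append] at hp
  have hτ₁ : cs.wordProd τ₁ ∈ parabolic cs J :=
    wordProd_mem_parabolic fun i hi => hγJ i (hs1.subset hi)
  have heq : cs.wordProd τ₂ = (cs.wordProd τ₁)⁻¹ * cs.wordProd γ * cs.wordProd ω := by
    rw [mul_assoc, ← hp, inv_mul_cancel_left]
  -- The product of `τ₂` lies in the same coset as the minimal element, so it is no shorter. A
  -- sublist of `ω` of that length is `ω` itself.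
  have hle := hmin' _ (mul_mem (inv_mem hτ₁) hc)
  rw [← heq, hω.eq] at hle
  have h2 : τ₂ = ω := hs2.eq_of_length_le (hle.trans (cs.length_wordProd_le _))
  subst h2
  have h1 : cs.wordProd τ₁ = cs.wordProd γ := mul_right_cancel hp
  have h3 := hred.eq
  rw [CoxeterSystem.wordProd_append, List.length_append, h1] at h3
  have h4 := cs.length_wordProd_le τ₁
  have h5 := cs.length_mul_le (cs.wordProd γ) (cs.wordProd τ₂)
  have h6 := hω.eq
  rw [h1] at h4
  omega

theorem length_mul_of_forall_simple {J : Set B} {w : W}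
    (h : ∀ i ∈ J, cs.length w < cs.length (cs.simple i * w)) {b : W} (hb : b ∈ parabolic cs J) :
    cs.length (b * w) = cs.length b + cs.length w := by
  obtain ⟨c, hc, w', rfl, hadd⟩ := exists_parabolic_mul (cs := cs) J w
  obtain ⟨γ, hγJ, hγ, rfl⟩ := exists_reduced_word_of_mem_parabolic hc
  cases γ with
  | nil => simpa using hadd b hb
  | cons i γ =>
    -- A nontrivial `W_J`-part would begin with a letter of `J` that shortens `w`.
    exfalso
    have h1 := h i (hγJ i (by simp))
    rw [hadd _ hc, hγ.eq, CoxeterSystem.wordProd_cons, ← mul_assoc,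
      CoxeterSystem.simple_mul_simple_cancel_left,
      hadd _ (wordProd_mem_parabolic fun j hj => hγJ j (List.mem_cons_of_mem _ hj)),
      List.length_cons] at h1
    have := cs.length_wordProd_le γ
    omega

/-- This replaces Bruhat minimality by the absence of descents in `J`. Bruhat comparison implies
comparison of lengths; conversely, additivity of lengths makes `w` a suffix of a reduced word of `b
* w`. -/
theorem mem_leftMin_iff {J : Set B} {w : W} :
    w ∈ leftMin cs J ↔ ∀ i ∈ J, cs.length w < cs.length (cs.simple i * w) := by
  rw [mem_leftMin_iff_bruhatLE]
  constructor
  · intro h i hi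
    exact lt_of_le_of_ne (h _ (simple_mem_parabolic hi)).length_le (cs.length_simple_mul_ne w i).symm
  · intro h b hb
    exact .of_length_mul (length_mul_of_forall_simple h hb)

theorem length_mul_of_mem_leftMin {J : Set B} {w : W} (hw : w ∈ leftMin cs J) {b : W}
    (hb : b ∈ parabolic cs J) : cs.length (b * w) = cs.length b + cs.length w :=
  length_mul_of_forall_simple (mem_leftMin_iff.mp hw) hb

theorem exists_mul_mem_leftMin (J : Set B) (w : W) :
    ∃ b ∈ parabolic cs J, ∃ w' ∈ leftMin cs J, w = b * w' := by
  obtain ⟨b, hb, w', rfl, hadd⟩ := exists_parabolic_mul (cs := cs) J w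
  refine ⟨b, hb, w', mem_leftMin_iff.mpr fun i hi => ?_, rfl⟩
  rw [hadd _ (simple_mem_parabolic hi), cs.length_simple]
  omega

theorem leftMin_anti {I J : Set B} (h : I ⊆ J) : leftMin cs J ⊆ leftMin cs I := fun _ hw =>
  mem_leftMin_iff.mpr fun i hi => mem_leftMin_iff.mp hw i (h hi)

theorem one_mem_leftMin (J : Set B) : (1 : W) ∈ leftMin cs J :=
  mem_leftMin_iff.mpr fun i _ => by simp

theorem eq_one_of_mul_length_le {J : Set B} {w b : W} (hw : w ∈ leftMin cs J)
    (hb : b ∈ parabolic cs J) (h : cs.length (b * w) ≤ cs.length w) : b = 1 := by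
  rw [length_mul_of_mem_leftMin hw hb] at h
  exact cs.length_eq_zero_iff.mp (by omega)

theorem eq_of_mem_leftMin {J : Set B} {y z : W} (hy : y ∈ leftMin cs J) (hz : z ∈ leftMin cs J)
    (h : y * z⁻¹ ∈ parabolic cs J) : y = z := by
  have h1 := length_mul_of_mem_leftMin hz h
  have h2 := length_mul_of_mem_leftMin hy (inv_mem h)
  simp only [mul_inv_rev, inv_inv, mul_assoc, inv_mul_cancel, mul_one] at h1 h2
  exact mul_inv_eq_one.mp (eq_one_of_mul_length_le hz h (by simp; omega))

/-- An element of `leftMin J` whose `W_J`-coset meets `W_K W_L` lies in `W_K W_L`. -/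
theorem exists_mul_of_mem_leftMin {J K L : Set B} {y b c q : W} (hy : y ∈ leftMin cs J)
    (hb : b ∈ parabolic cs J) (hc : c ∈ parabolic cs K) (hq : q ∈ parabolic cs L)
    (h : b * y = c * q) : ∃ c' ∈ parabolic cs K, ∃ q' ∈ parabolic cs L, y = c' * q' := by
  obtain ⟨β, hβ, rfl⟩ := cs.exists_isReduced b
  obtain ⟨γ, hγ, rfl⟩ := exists_word_of_mem_parabolic hc
  obtain ⟨τ, hτ, rfl⟩ := exists_word_of_mem_parabolic hq
  obtain ⟨ω, hsub, rfl⟩ := exists_sublist_of_length_add cs β (y := y) (ω := γ ++ τ)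
    (by rw [CoxeterSystem.wordProd_append, h]) (by rw [length_mul_of_mem_leftMin hy hb, hβ.eq])
  obtain ⟨ω₁, ω₂, rfl, hs1, hs2⟩ := List.sublist_append_iff.mp hsub
  exact ⟨_, wordProd_mem_parabolic fun i hi => hγ i (hs1.subset hi), _,
    wordProd_mem_parabolic fun i hi => hτ i (hs2.subset hi), CoxeterSystem.wordProd_append ..⟩

/-- A simple reflection in `W_I` is one of the generators of `W_I`. -/
theorem exists_simple_eq_of_mem_parabolic {I : Set B} {i : B} (h : cs.simple i ∈ parabolic cs I) :
    ∃ j ∈ I, cs.simple i = cs.simple j := by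
  obtain ⟨ω, hI, hred, hp⟩ := exists_reduced_word_of_mem_parabolic h
  have hl := hred.eq
  rw [hp, cs.length_simple] at hl
  obtain ⟨j, rfl⟩ := List.length_eq_one_iff.mp hl.symm
  exact ⟨j, hI j (by simp), by simpa using hp.symm⟩

/-- A simple reflection outside `W_I` that conjugates a generator `s_j` of `W_I` into `W_I`
commutes with `s_j`. -/
theorem simple_commute_of_conj_mem {I : Set B} {i j : B} (hi : cs.simple i ∉ parabolic cs I)
    (hj : j ∈ I) (h : cs.simple i * cs.simple j * cs.simple i ∈ parabolic cs I) :
    cs.simple i * cs.simple j = cs.simple j * cs.simple i := by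
  have hmin : cs.simple i ∈ leftMin cs I := mem_leftMin_iff.mpr fun k hk => by
    rcases cs.length_simple_mul (cs.simple i) k with hl | hl
    · omega
    · rw [cs.length_simple] at hl
      have : cs.simple k * cs.simple i = 1 := cs.length_eq_zero_iff.mp (by omega)
      rw [mul_eq_one_iff_eq_inv, CoxeterSystem.inv_simple] at this
      exact absurd (this ▸ simple_mem_parabolic hk) hi
  -- Additivity gives `ℓ(s_i s_j) = ℓ(s_i s_j s_i) + 1`, so the conjugate has length at most one and
  -- is a simple reflection `s_k`.
  have h1 := length_mul_of_mem_leftMin hmin h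
  rw [CoxeterSystem.simple_mul_simple_cancel_right, cs.length_simple] at h1
  have h2 := cs.length_mul_le (cs.simple i) (cs.simple j)
  rw [cs.length_simple, cs.length_simple] at h2
  have h0 : cs.length (cs.simple i * cs.simple j * cs.simple i) ≠ 0 := by
    intro h0
    have h3 := cs.length_eq_zero_iff.mp h0
    rw [h3] at h
    have h4 : cs.simple j = 1 := by
      have h5 : cs.simple i * (cs.simple i * cs.simple j * cs.simple i) * cs.simple i = 1 := by
        simp [h3]
      simpa [mul_assoc] using h5
    have := cs.length_simple j
    simp [h4] at this
  obtain ⟨k, hk⟩ := cs.length_eq_one_iff.mp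
    (show cs.length (cs.simple i * cs.simple j * cs.simple i) = 1 by omega)
  -- As `s_k` lies in the parabolic subgroup of `{i, j}`, it is `s_i`, excluded by `hi`, or `s_j`.
  have hkm : cs.simple k ∈ parabolic cs ({i, j} : Set B) := by
    rw [← hk]
    exact mul_mem (mul_mem (simple_mem_parabolic (by simp)) (simple_mem_parabolic (by simp)))
      (simple_mem_parabolic (by simp))
  obtain ⟨l, hl, hkl⟩ := exists_simple_eq_of_mem_parabolic hkm
  have hij : cs.simple i * cs.simple j = cs.simple k * cs.simple i := by
    rw [← hk, CoxeterSystem.simple_mul_simple_cancel_right]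
  rcases hl with rfl | rfl
  · exact absurd (by rw [← hkl, ← hk]; exact h) hi
  · rw [hij, hkl]

end CoxeterGroups
end RennerCoxeter

namespace RennerCoxeter

/-! ### Inverse monoids: the involution and Green's relations. -/

section FactorizableMonoids

variable {R : Type*} [Monoid R]

theorem isIdempotentElem_conj {e : R} (he : IsIdempotentElem e) (w : Rˣ) :
    IsIdempotentElem ((w : R) * e * ((w⁻¹ : Rˣ) : R)) := by
  unfold IsIdempotentElem
  simp only [mul_assoc, Units.inv_mul_cancel_left]
  rw [← mul_assoc e e, he.eq]

theorem isInverseOf_invStar (h : IsInverseMonoid R) (r : R) : IsInverseOf (invStar h r) r :=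
  (h r).choose_spec.1

theorem eq_invStar (h : IsInverseMonoid R) {n r : R} (hn : IsInverseOf n r) : n = invStar h r :=
  (h r).choose_spec.2 n hn

theorem invStar_invStar (h : IsInverseMonoid R) (r : R) : invStar h (invStar h r) = r :=
  (eq_invStar h (isInverseOf_invStar h r).symm).symm

theorem invStar_image_eq (h : IsInverseMonoid R) {A C : Set R} (hAC : ∀ r ∈ A, invStar h r ∈ C)
    (hCA : ∀ r ∈ C, invStar h r ∈ A) : invStar h '' A = C := by
  ext r
  constructor
  · rintro ⟨s, hs, rfl⟩
    exact hAC s hs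
  · intro hr
    exact ⟨_, hCA r hr, invStar_invStar h r⟩

theorem mul_invStar_mul (h : IsInverseMonoid R) (r : R) : r * (invStar h r * r) = r := by
  rw [← mul_assoc]
  exact (isInverseOf_invStar h r).1

theorem isIdempotentElem_invStar_mul (h : IsInverseMonoid R) (r : R) :
    IsIdempotentElem (invStar h r * r) := by
  unfold IsIdempotentElem
  rw [mul_assoc, mul_invStar_mul]

theorem isIdempotentElem_mul_invStar (h : IsInverseMonoid R) (r : R) :
    IsIdempotentElem (r * invStar h r) := by
  simpa [invStar_invStar] using isIdempotentElem_invStar_mul h (invStar h r)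

theorem mul_invStar_mul_self (h : IsInverseMonoid R) (r : R) : r * invStar h r * r = r :=
  (isInverseOf_invStar h r).1

theorem invStar_of_isIdempotentElem (h : IsInverseMonoid R) {e : R} (he : IsIdempotentElem e) :
    invStar h e = e :=
  (eq_invStar h ⟨by rw [he.eq, he.eq], by rw [he.eq, he.eq]⟩).symm

theorem invStar_mul (h : IsInverseMonoid R)
    (hc : ∀ e f : R, IsIdempotentElem e → IsIdempotentElem f → e * f = f * e) (r s : R) :
    invStar h (r * s) = invStar h s * invStar h r := by
  have key : ∀ a b : R, a * b * (invStar h b * invStar h a) * (a * b) = a * b := fun a b =>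
    calc a * b * (invStar h b * invStar h a) * (a * b)
        = a * ((b * invStar h b) * (invStar h a * a)) * b := by simp only [mul_assoc]
      _ = a * ((invStar h a * a) * (b * invStar h b)) * b := by
          rw [hc _ _ (isIdempotentElem_mul_invStar h b) (isIdempotentElem_invStar_mul h a)]
      _ = (a * (invStar h a * a)) * (b * (invStar h b * b)) := by simp only [mul_assoc]
      _ = a * b := by rw [mul_invStar_mul, mul_invStar_mul]
  refine (eq_invStar h ⟨key r s, ?_⟩).symm
  simpa only [invStar_invStar] using key (invStar h s) (invStar h r)

theorem invStar_units_mul_mul (h : IsInverseMonoid R) {e : R} (he : IsIdempotentElem e)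
    (x y : Rˣ) : invStar h (x * e * y) = ((y⁻¹ : Rˣ) : R) * e * ((x⁻¹ : Rˣ) : R) := by
  refine (eq_invStar h ⟨?_, ?_⟩).symm <;>
  · simp only [mul_assoc, Units.mul_inv_cancel_left, Units.inv_mul_cancel_left]
    simp only [← mul_assoc]
    simp only [mul_assoc _ e e, he.eq]

/-- If each of `r`, `s` is a left multiple of the other, then each is fixed on the right by the
idempotent of the other. Since `r* r` and `s* s` commute, they coincide. -/
theorem greenL_iff (h : IsInverseMonoid R)
    (hc : ∀ e f : R, IsIdempotentElem e → IsIdempotentElem f → e * f = f * e) {r s : R} :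
    greenL R r s ↔ invStar h r * r = invStar h s * s := by
  constructor
  · intro hrs
    have hrs : (Set.range fun t : R => t * r) = Set.range fun t : R => t * s := hrs
    obtain ⟨p, hp⟩ : r ∈ Set.range fun t : R => t * s := hrs ▸ ⟨1, one_mul r⟩
    obtain ⟨q, hq⟩ : s ∈ Set.range fun t : R => t * r := hrs ▸ ⟨1, one_mul s⟩
    have h1 : r * (invStar h s * s) = r := by
      rw [← hp]
      change p * s * (invStar h s * s) = p * s
      rw [mul_assoc, mul_invStar_mul]
    have h2 : s * (invStar h r * r) = s := by
      rw [← hq]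
      change q * r * (invStar h r * r) = q * r
      rw [mul_assoc, mul_invStar_mul]
    calc invStar h r * r = invStar h r * (r * (invStar h s * s)) := by rw [h1]
      _ = (invStar h r * r) * (invStar h s * s) := by rw [mul_assoc]
      _ = (invStar h s * s) * (invStar h r * r) :=
          hc _ _ (isIdempotentElem_invStar_mul h r) (isIdempotentElem_invStar_mul h s)
      _ = invStar h s * (s * (invStar h r * r)) := by rw [mul_assoc]
      _ = invStar h s * s := by rw [h2]
  · intro hrs
    have key : ∀ a b : R, invStar h a * a = invStar h b * b →
        (Set.range fun t : R => t * a) ⊆ Set.range fun t : R => t * b := by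
      rintro a b hab _ ⟨t, rfl⟩
      refine ⟨t * a * invStar h b, ?_⟩
      change t * a * invStar h b * b = t * a
      rw [mul_assoc, ← hab, mul_assoc, mul_invStar_mul]
    exact Set.Subset.antisymm (key r s hrs) (key s r hrs.symm)

theorem greenR_iff (h : IsInverseMonoid R)
    (hc : ∀ e f : R, IsIdempotentElem e → IsIdempotentElem f → e * f = f * e) {r s : R} :
    greenR R r s ↔ r * invStar h r = s * invStar h s := by
  constructor
  · intro hrs
    have hrs : (Set.range fun t : R => r * t) = Set.range fun t : R => s * t := hrs
    obtain ⟨p, hp⟩ : r ∈ Set.range fun t : R => s * t := hrs ▸ ⟨1, mul_one r⟩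
    obtain ⟨q, hq⟩ : s ∈ Set.range fun t : R => r * t := hrs ▸ ⟨1, mul_one s⟩
    have h1 : s * invStar h s * r = r := by
      rw [← hp]
      change s * invStar h s * (s * p) = s * p
      rw [← mul_assoc, mul_invStar_mul_self]
    have h2 : r * invStar h r * s = s := by
      rw [← hq]
      change r * invStar h r * (r * q) = r * q
      rw [← mul_assoc, mul_invStar_mul_self]
    calc r * invStar h r = s * invStar h s * r * invStar h r := by rw [h1]
      _ = (s * invStar h s) * (r * invStar h r) := by rw [mul_assoc]
      _ = (r * invStar h r) * (s * invStar h s) :=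
          hc _ _ (isIdempotentElem_mul_invStar h s) (isIdempotentElem_mul_invStar h r)
      _ = r * invStar h r * s * invStar h s := by rw [← mul_assoc (r * invStar h r)]
      _ = s * invStar h s := by rw [h2]
  · intro hrs
    have key : ∀ a b : R, a * invStar h a = b * invStar h b →
        (Set.range fun t : R => a * t) ⊆ Set.range fun t : R => b * t := by
      rintro a b hab _ ⟨t, rfl⟩
      refine ⟨invStar h b * (a * t), ?_⟩
      change b * (invStar h b * (a * t)) = a * t
      rw [← mul_assoc, ← hab, ← mul_assoc, mul_invStar_mul_self]
    exact Set.Subset.antisymm (key r s hrs) (key s r hrs.symm)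

theorem greenR_iff_greenL_invStar (h : IsInverseMonoid R)
    (hc : ∀ e f : R, IsIdempotentElem e → IsIdempotentElem f → e * f = f * e) {r s : R} :
    greenR R r s ↔ greenL R (invStar h r) (invStar h s) := by
  rw [greenR_iff h hc, greenL_iff h hc, invStar_invStar, invStar_invStar]

theorem greenL_iff_greenR_invStar (h : IsInverseMonoid R)
    (hc : ∀ e f : R, IsIdempotentElem e → IsIdempotentElem f → e * f = f * e) {r s : R} :
    greenL R r s ↔ greenR R (invStar h r) (invStar h s) := by
  rw [greenR_iff h hc, greenL_iff h hc, invStar_invStar, invStar_invStar]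

end FactorizableMonoids

/-! ### Centralizers and fixers of the elements of `Λ`. -/

section GeneralizedRennerCoxeterSystems

variable {R : Type*} [Monoid R] {B : Type*} {M : CoxeterMatrix B} {cs : CoxeterSystem M Rˣ}
  {Λ : Set R}

theorem upperType_subset_typeMap (e : R) : upperType cs e ⊆ typeMap cs e := fun _ hi => hi.1

theorem lowerType_subset_typeMap (e : R) : lowerType cs e ⊆ typeMap cs e := fun _ hi =>
  hi.1.trans hi.2.symm

theorem mem_lowerType_or_upperType {e : R} {i : B} (hi : i ∈ typeMap cs e) :
    i ∈ lowerType cs e ∨ i ∈ upperType cs e := by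
  by_cases h : e * cs.simple i = e
  · exact Or.inl ⟨Eq.trans hi h, h⟩
  · exact Or.inr ⟨hi, h⟩

namespace IsSystem

variable (h : IsSystem cs Λ)

include h

theorem comm {e f : R} (he : IsIdempotentElem e) (hf : IsIdempotentElem f) : e * f = f * e :=
  h.factorizable.idem_comm e f he hf

theorem isIdempotentElem_mul {e f : R} (he : IsIdempotentElem e) (hf : IsIdempotentElem f) :
    IsIdempotentElem (e * f) :=
  he.mul_of_commute (h.comm he hf) hf

theorem conj_eq {e f : R} (he : e ∈ Λ) (hf : f ∈ Λ) {w : Rˣ}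
    (hw : (w : R) * e * ((w⁻¹ : Rˣ) : R) = f) : e = f :=
  (h.transversal e (h.idem e he)).unique ⟨he, 1, by simp⟩ ⟨hf, w, hw⟩

theorem one_mem : (1 : R) ∈ Λ := by
  obtain ⟨f, ⟨hf, w, hw⟩, -⟩ := h.transversal 1 IsIdempotentElem.one
  rw [mul_one, Units.mul_inv] at hw
  rwa [hw]

theorem commute_of_mem {e : R} (he : e ∈ Λ) {w : Rˣ} (hw : w ∈ parabolic cs (typeMap cs e)) :
    (w : R) * e = e * w :=
  (h.mem_parabolic_typeMap he w).mp hw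

theorem conj_of_mem {e : R} (he : e ∈ Λ) {w : Rˣ} (hw : w ∈ parabolic cs (typeMap cs e)) :
    (w : R) * e * ((w⁻¹ : Rˣ) : R) = e := by
  rw [h.commute_of_mem he hw, mul_assoc, Units.mul_inv, mul_one]

theorem mem_of_conj {e : R} (he : e ∈ Λ) {w : Rˣ}
    (hw : (w : R) * e * ((w⁻¹ : Rˣ) : R) = e) : w ∈ parabolic cs (typeMap cs e) := by
  rw [h.mem_parabolic_typeMap he]
  nth_rw 2 [← hw]
  rw [mul_assoc, Units.inv_mul, mul_one]

theorem mul_of_mem_lower {e : R} (he : e ∈ Λ) {w : Rˣ}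
    (hw : w ∈ parabolic cs (lowerType cs e)) : e * w = e :=
  ((h.mem_parabolic_lowerType he w).mp hw).2

theorem of_mem_lower_mul {e : R} (he : e ∈ Λ) {w : Rˣ}
    (hw : w ∈ parabolic cs (lowerType cs e)) : w * e = e := by
  have := (h.mem_parabolic_lowerType he w).mp hw
  exact this.1.trans this.2

/-- One-sided fixing suffices: `w e w⁻¹ = e w⁻¹` is an idempotent, and its commuting with `e` forces
`e w⁻¹ = e`. -/
theorem mem_lower_of_mul_eq {e : R} (he : e ∈ Λ) {w : Rˣ} (hw : (w : R) * e = e) :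
    w ∈ parabolic cs (lowerType cs e) := by
  have hw' : ((w⁻¹ : Rˣ) : R) * e = e := by
    nth_rw 1 [← hw]
    rw [Units.inv_mul_cancel_left]
  have h1 : IsIdempotentElem (e * ((w⁻¹ : Rˣ) : R)) := by
    have := isIdempotentElem_conj (h.idem e he) w
    rwa [hw] at this
  have h2 := h.comm (h.idem e he) h1
  rw [← mul_assoc, (h.idem e he).eq, mul_assoc, hw', (h.idem e he).eq] at h2
  have h3 : e * w = e := by
    nth_rw 1 [← h2]
    rw [mul_assoc, Units.inv_mul, mul_one]
  exact (h.mem_parabolic_lowerType he w).mpr ⟨hw.trans h3.symm, h3⟩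

/-- For `j ∈ λ_*(e)` the conjugate `s_i s_j s_i` still fixes `e`, so it lies in `W_{λ_*(e)}`, while
`s_i` does not. Hence `simple_commute_of_conj_mem` applies to each generator. -/
theorem simple_commute {e : R} (he : e ∈ Λ) {i : B} (hi : i ∈ upperType cs e) {b : Rˣ}
    (hb : b ∈ parabolic cs (lowerType cs e)) : cs.simple i * b = b * cs.simple i := by
  have hi' : cs.simple i ∉ parabolic cs (lowerType cs e) := fun hm =>
    hi.2 (h.mul_of_mem_lower he hm)
  suffices b ∈ Subgroup.centralizer {cs.simple i} from
    Subgroup.mem_centralizer_singleton_iff.mp this |>.symm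
  refine (Subgroup.closure_le _).mpr ?_ hb
  rintro _ ⟨j, hj, rfl⟩
  rw [SetLike.mem_coe, Subgroup.mem_centralizer_singleton_iff]
  refine (simple_commute_of_conj_mem hi' hj (h.mem_lower_of_mul_eq he ?_)).symm
  have hsq : (cs.simple i : R) * cs.simple i = 1 := by
    rw [← Units.val_mul, CoxeterSystem.simple_mul_simple_self, Units.val_one]
  rw [Units.val_mul, Units.val_mul, mul_assoc, hi.1, mul_assoc (cs.simple i : R),
    ← mul_assoc (cs.simple j : R), hj.1, ← hi.1, ← mul_assoc, hsq, one_mul]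

theorem exists_upper_mul_lower {e : R} (he : e ∈ Λ) {w : Rˣ}
    (hw : w ∈ parabolic cs (typeMap cs e)) :
    ∃ u ∈ parabolic cs (upperType cs e), ∃ v ∈ parabolic cs (lowerType cs e), w = u * v := by
  obtain ⟨ω, hω, rfl⟩ := exists_word_of_mem_parabolic hw
  clear hw
  induction ω with
  | nil => exact ⟨1, Subgroup.one_mem _, 1, Subgroup.one_mem _, by simp⟩
  | cons i ω ih =>
    obtain ⟨u, hu, v, hv, huv⟩ := ih fun j hj => hω j (List.mem_cons_of_mem _ hj)
    rw [CoxeterSystem.wordProd_cons, huv]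
    -- A lower letter is moved past the upper factor `u`, with which it commutes.
    rcases mem_lowerType_or_upperType (hω i (by simp)) with hi | hi
    · refine ⟨u, hu, cs.simple i * v, Subgroup.mul_mem _ (simple_mem_parabolic hi) hv, ?_⟩
      have : u ∈ Subgroup.centralizer {cs.simple i} := by
        refine (Subgroup.closure_le _).mpr ?_ hu
        rintro _ ⟨j, hj, rfl⟩
        exact Subgroup.mem_centralizer_singleton_iff.mpr
          (h.simple_commute he hj (simple_mem_parabolic hi))
      rw [← mul_assoc, ← mul_assoc, ← Subgroup.mem_centralizer_singleton_iff.mp this]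
    · exact ⟨cs.simple i * u, Subgroup.mul_mem _ (simple_mem_parabolic hi) hu, v, hv, (mul_assoc _ _ _).symm⟩

omit h in
theorem upper_mul_lower_mem {e : R} {u v : Rˣ} (hu : u ∈ parabolic cs (upperType cs e))
    (hv : v ∈ parabolic cs (lowerType cs e)) : u * v ∈ parabolic cs (typeMap cs e) :=
  Subgroup.mul_mem _ (parabolic_mono (upperType_subset_typeMap e) hu)
    (parabolic_mono (lowerType_subset_typeMap e) hv)

/-! ### Standard forms -/

/-- An idempotent is determined by its representative in `Λ` and a minimal coset
representative, uniquely. -/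
theorem conj_eq_conj {e f : R} (he : e ∈ Λ) (hf : f ∈ Λ) {y z : Rˣ}
    (hy : y ∈ leftMin cs (typeMap cs e)) (hz : z ∈ leftMin cs (typeMap cs f))
    (hyz : ((y⁻¹ : Rˣ) : R) * e * y = ((z⁻¹ : Rˣ) : R) * f * z) : e = f ∧ y = z := by
  have key : ((z * y⁻¹ : Rˣ) : R) * e * (((z * y⁻¹)⁻¹ : Rˣ) : R) = f := by
    have : ((z * y⁻¹ : Rˣ) : R) * e * (((z * y⁻¹)⁻¹ : Rˣ) : R) =
        z * (((y⁻¹ : Rˣ) : R) * e * y) * ((z⁻¹ : Rˣ) : R) := by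
      simp only [mul_inv_rev, inv_inv, Units.val_mul, mul_assoc]
    rw [this, hyz]
    simp only [mul_assoc, Units.mul_inv, Units.mul_inv_cancel_left, mul_one]
  obtain rfl := h.conj_eq he hf key
  exact ⟨rfl, (eq_of_mem_leftMin hz hy (h.mem_of_conj he key)).symm⟩

theorem invStar_mul_self {x y : Rˣ} {e : R} (he : e ∈ Λ) :
    invStar h.factorizable.isInverseMonoid (x * e * y) * (x * e * y) =
      ((y⁻¹ : Rˣ) : R) * e * y := by
  rw [invStar_units_mul_mul _ (h.idem e he)]
  simp only [mul_assoc, Units.inv_mul_cancel_left]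
  rw [← mul_assoc e e, (h.idem e he).eq]

theorem self_mul_invStar {x y : Rˣ} {e : R} (he : e ∈ Λ) :
    (x * e * y) * invStar h.factorizable.isInverseMonoid (x * e * y) =
      x * e * ((x⁻¹ : Rˣ) : R) := by
  rw [invStar_units_mul_mul _ (h.idem e he)]
  simp only [mul_assoc, Units.mul_inv_cancel_left]
  rw [← mul_assoc e e, (h.idem e he).eq]

theorem greenL_form_iff {e f : R} (he : e ∈ Λ) (hf : f ∈ Λ) {x y a z : Rˣ}
    (hy : y ∈ leftMin cs (typeMap cs e)) (hz : z ∈ leftMin cs (typeMap cs f)) :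
    greenL R (x * e * y) (a * f * z) ↔ e = f ∧ y = z := by
  rw [greenL_iff h.factorizable.isInverseMonoid h.factorizable.idem_comm, h.invStar_mul_self he,
    h.invStar_mul_self hf]
  refine ⟨h.conj_eq_conj he hf hy hz, ?_⟩
  rintro ⟨rfl, rfl⟩
  rfl

theorem leftForm_unique {r e e' : R} {x y x' y' : Rˣ} (h1 : IsLeftForm cs Λ r x e y)
    (h2 : IsLeftForm cs Λ r x' e' y') : x = x' ∧ e = e' ∧ y = y' := by
  obtain ⟨he, hx, hy, rfl⟩ := h1
  obtain ⟨he', hx', hy', heq⟩ := h2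
  have hL : greenL R (x * e * y) (x' * e' * y') := by rw [← heq]
  obtain ⟨rfl, rfl⟩ := (h.greenL_form_iff he he' hy hy').mp hL
  refine ⟨?_, rfl, rfl⟩
  have hxe : (x : R) * e = x' * e := by
    simpa [mul_assoc] using congrArg (fun t : R => t * ((y⁻¹ : Rˣ) : R)) heq
  have hmem : x⁻¹ * x'⁻¹⁻¹ ∈ parabolic cs (lowerType cs e) := by
    refine h.mem_lower_of_mul_eq he ?_
    rw [inv_inv, Units.val_mul, mul_assoc, ← hxe, Units.inv_mul_cancel_left]
  exact inv_injective (eq_of_mem_leftMin (mem_rightMin_iff.mp hx) (mem_rightMin_iff.mp hx') hmem)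

theorem exists_unit_mul_unit (r : R) :
    ∃ (x : Rˣ), ∃ e ∈ Λ, ∃ y ∈ leftMin cs (typeMap cs e), r = x * e * y := by
  obtain ⟨w, f, hf, rfl⟩ := h.factorizable.unit_mul_idem r
  obtain ⟨e, ⟨he, u, rfl⟩, -⟩ := h.transversal f hf
  -- With `f = u⁻¹ e u`, the part `b` of `u` in `W_{λ(e)}` centralizes `e` and cancels.
  obtain ⟨b, hb, y, hy, rfl⟩ := exists_mul_mem_leftMin (cs := cs)
    (typeMap cs ((u : R) * f * ((u⁻¹ : Rˣ) : R))) u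
  set e := ((b * y : Rˣ) : R) * f * (((b * y)⁻¹ : Rˣ) : R) with hedef
  refine ⟨w * y⁻¹, e, he, y, hy, ?_⟩
  have hbe := h.conj_of_mem he (inv_mem hb)
  rw [inv_inv] at hbe
  nth_rw 1 [← hbe]
  rw [hedef]
  simp only [mul_inv_rev, Units.val_mul, mul_assoc, Units.inv_mul_cancel_left, Units.inv_mul,
    mul_one]

theorem exists_leftForm (r : R) : ∃ (x : Rˣ) (e : R) (y : Rˣ), IsLeftForm cs Λ r x e y := by
  obtain ⟨x, e, he, y, hy, rfl⟩ := h.exists_unit_mul_unit r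
  obtain ⟨b, hb, x', hx', hbx⟩ := exists_mul_mem_leftMin (cs := cs) (lowerType cs e) x⁻¹
  refine ⟨x'⁻¹, e, y, he, mem_rightMin_iff.mpr (by rwa [inv_inv]), hy, ?_⟩
  rw [inv_eq_iff_eq_inv] at hbx
  rw [hbx, mul_inv_rev, Units.val_mul, mul_assoc (((x'⁻¹ : Rˣ) : R)),
    h.of_mem_lower_mul he (inv_mem hb)]

theorem rightForm_invStar {r e : R} {x y : Rˣ} (hr : IsRightForm cs Λ r y e x) :
    IsLeftForm cs Λ (invStar h.factorizable.isInverseMonoid r) x⁻¹ e y⁻¹ := by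
  obtain ⟨he, hx, hy, rfl⟩ := hr
  exact ⟨he, mem_rightMin_iff.mpr (by rwa [inv_inv]), mem_rightMin_iff.mp hy,
    invStar_units_mul_mul _ (h.idem e he) _ _⟩

theorem leftForm_invStar {r e : R} {x y : Rˣ} (hr : IsLeftForm cs Λ r x e y) :
    IsRightForm cs Λ (invStar h.factorizable.isInverseMonoid r) y⁻¹ e x⁻¹ := by
  obtain ⟨he, hx, hy, rfl⟩ := hr
  exact ⟨he, mem_rightMin_iff.mp hx, mem_rightMin_iff.mpr (by rwa [inv_inv]),
    invStar_units_mul_mul _ (h.idem e he) _ _⟩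

theorem adhMinus_invStar {r s : R} (hrs : AdhPlus cs Λ r s) :
    AdhMinus cs Λ (invStar h.factorizable.isInverseMonoid r)
      (invStar h.factorizable.isInverseMonoid s) := by
  obtain ⟨x, e, y, a, f, b, hr, hs, hef, u, hu, v, hv, h1, h2⟩ := hrs
  refine ⟨_, e, _, _, f, _, h.leftForm_invStar hr, h.leftForm_invStar hs, hef, v⁻¹, inv_mem hv,
    u⁻¹, inv_mem hu, ?_, ?_⟩
  · simpa [mul_assoc] using h1.inv
  · simpa [mul_assoc] using h2.inv

theorem adhPlus_invStar {r s : R} (hrs : AdhMinus cs Λ r s) :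
    AdhPlus cs Λ (invStar h.factorizable.isInverseMonoid r)
      (invStar h.factorizable.isInverseMonoid s) := by
  obtain ⟨y, e, x, b, f, a, hr, hs, hef, v, hv, u, hu, h1, h2⟩ := hrs
  refine ⟨_, e, _, _, f, _, h.rightForm_invStar hr, h.rightForm_invStar hs, hef, u⁻¹, inv_mem hu,
    v⁻¹, inv_mem hv, ?_, ?_⟩
  · simpa [mul_assoc] using h1.inv
  · simpa [mul_assoc] using h2.inv

/-- This is the bridge that transports the statements about `≤⁺` to `≤⁻`. -/
theorem adhMinus_iff {r s : R} : AdhMinus cs Λ r s ↔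
    AdhPlus cs Λ (invStar h.factorizable.isInverseMonoid r)
      (invStar h.factorizable.isInverseMonoid s) :=
  ⟨h.adhPlus_invStar, fun hrs => by simpa only [invStar_invStar] using h.adhMinus_invStar hrs⟩

/-! ### The sets `GJ`, `JG` and `OSet` -/

theorem invStar_mem_JG {r : R} (hr : r ∈ GJ cs Λ) :
    invStar h.factorizable.isInverseMonoid r ∈ JG cs Λ := by
  obtain ⟨e, y, hr⟩ := hr
  exact ⟨_, e, by simpa using h.leftForm_invStar hr⟩

theorem invStar_mem_GJ {r : R} (hr : r ∈ JG cs Λ) :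
    invStar h.factorizable.isInverseMonoid r ∈ GJ cs Λ := by
  obtain ⟨y, e, hr⟩ := hr
  exact ⟨e, _, by simpa using h.rightForm_invStar hr⟩

theorem mem_JG_iff {r : R} :
    r ∈ JG cs Λ ↔ invStar h.factorizable.isInverseMonoid r ∈ GJ cs Λ :=
  ⟨h.invStar_mem_GJ, fun hr => by simpa only [invStar_invStar] using h.invStar_mem_JG hr⟩

omit h in
theorem mem_GJ_iff {r : R} :
    r ∈ GJ cs Λ ↔ ∃ e ∈ Λ, ∃ y ∈ leftMin cs (typeMap cs e), r = e * y := by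
  constructor
  · rintro ⟨e, y, he, -, hy, rfl⟩
    exact ⟨e, he, y, hy, by simp⟩
  · rintro ⟨e, he, y, hy, rfl⟩
    exact ⟨e, y, he, mem_rightMin_iff.mpr (by simpa using one_mem_leftMin _), hy, by simp⟩

theorem mem_OSet_iff {r : R} :
    r ∈ OSet cs Λ ↔ ∃ e ∈ Λ, ∃ a : Rˣ, a⁻¹ ∈ leftMin cs (typeMap cs e) ∧
      ∃ c ∈ leftMin cs (typeMap cs e), r = a * e * c := by
  constructor
  · rintro ⟨a, e, c, he, ha, -, hc, rfl⟩
    refine ⟨e, he, a, mem_rightMin_iff.mp ha, c, hc, ?_⟩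
    rw [Units.val_one, mul_one, mul_assoc (a : R) e e, (h.idem e he).eq]
  · rintro ⟨e, he, a, ha, c, hc, rfl⟩
    refine ⟨a, e, c, he, mem_rightMin_iff.mpr ha, Subgroup.one_mem _, hc, ?_⟩
    rw [Units.val_one, mul_one, mul_assoc (a : R) e e, (h.idem e he).eq]

theorem invStar_mem_OSet {r : R} (hr : r ∈ OSet cs Λ) :
    invStar h.factorizable.isInverseMonoid r ∈ OSet cs Λ := by
  obtain ⟨e, he, a, ha, c, hc, rfl⟩ := h.mem_OSet_iff.mp hr
  exact h.mem_OSet_iff.mpr ⟨e, he, c⁻¹, by rwa [inv_inv], a⁻¹, ha,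
    invStar_units_mul_mul _ (h.idem e he) _ _⟩

theorem GJ_subset_OSet : GJ cs Λ ⊆ OSet cs Λ := by
  intro r hr
  obtain ⟨e, he, y, hy, rfl⟩ := mem_GJ_iff.mp hr
  exact h.mem_OSet_iff.mpr ⟨e, he, 1, by simpa using one_mem_leftMin _, y, hy, by simp⟩

theorem JG_subset_OSet : JG cs Λ ⊆ OSet cs Λ := fun r hr => by
  simpa only [invStar_invStar] using
    h.invStar_mem_OSet (h.GJ_subset_OSet (h.invStar_mem_GJ hr))

/-- For `y` minimal with respect to the upper type of `e`, the product `e y` equals `e y'` with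
`y'` minimal with respect to the type of `e`. -/
theorem exists_leftMin_typeMap {e : R} (he : e ∈ Λ) {y : Rˣ}
    (hy : y ∈ leftMin cs (upperType cs e)) :
    ∃ y' ∈ leftMin cs (typeMap cs e), ∃ v ∈ parabolic cs (lowerType cs e), y = v * y' := by
  obtain ⟨v, hv, y', hy', rfl⟩ := exists_mul_mem_leftMin (cs := cs) (lowerType cs e) y
  refine ⟨y', mem_leftMin_iff.mpr fun i hi => ?_, v, hv, rfl⟩
  rcases mem_lowerType_or_upperType hi with hi | hi
  · exact mem_leftMin_iff.mp hy' i hi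
  · have h1 := mem_leftMin_iff.mp hy i hi
    rw [← mul_assoc, h.simple_commute he hi hv, mul_assoc, length_mul_of_mem_leftMin hy' hv] at h1
    have h2 := cs.length_mul_le v (cs.simple i * y')
    omega

/-- Minimality for the upper type is enough, because the remaining factors in `W_{λ_*(e)}` are
absorbed by `e`. -/
theorem mem_OSet_of_leftMin_upperType {e : R} (he : e ∈ Λ) {a c : Rˣ}
    (ha : a⁻¹ ∈ leftMin cs (upperType cs e)) (hc : c ∈ leftMin cs (upperType cs e)) :
    (a : R) * e * c ∈ OSet cs Λ := by
  obtain ⟨c', hc', v, hv, rfl⟩ := h.exists_leftMin_typeMap he hc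
  obtain ⟨a', ha', w, hw, haw⟩ := h.exists_leftMin_typeMap he ha
  rw [inv_eq_iff_eq_inv] at haw
  refine h.mem_OSet_iff.mpr ⟨e, he, a'⁻¹, by rwa [inv_inv], c', hc', ?_⟩
  rw [haw, mul_inv_rev, Units.val_mul, Units.val_mul, mul_assoc ((a'⁻¹ : Rˣ) : R),
    h.of_mem_lower_mul he (inv_mem hw), ← mul_assoc, mul_assoc _ e, h.mul_of_mem_lower he hv]

theorem idempotent_mem_OSet {f : R} (hf : IsIdempotentElem f) : f ∈ OSet cs Λ := by
  obtain ⟨x, e, he, y, hy, rfl⟩ := h.exists_unit_mul_unit f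
  have h1 := h.invStar_mul_self (x := x) (y := y) he
  rw [invStar_of_isIdempotentElem _ hf, hf.eq] at h1
  exact h.mem_OSet_iff.mpr ⟨e, he, y⁻¹, by rwa [inv_inv], y, hy, h1⟩

/-! ### Closure under products, and generation. -/

/-- An idempotent below `e ∈ Λ` is conjugate to an element of `Λ` below `e` by an element of the
centralizer of `e`. -/
theorem exists_conj_of_le {e F : R} (he : e ∈ Λ) (hF : IsIdempotentElem F) (hFe : IdemLE F e) :
    ∃ u ∈ parabolic cs (typeMap cs e), ∃ f ∈ Λ, IdemLE f e ∧ F = ((u⁻¹ : Rˣ) : R) * f * u := by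
  obtain ⟨u, f, hf, e', he', hfe, rfl, hu⟩ := h.conj_pair F e hF (h.idem e he) hFe
  obtain rfl := h.conj_eq he he' hu
  refine ⟨u, h.mem_of_conj he hu, _, hf, hfe, ?_⟩
  simp only [mul_assoc, Units.inv_mul, mul_one, Units.inv_mul_cancel_left]

theorem mul_idempotent_mem_OSet {r E : R} (hr : r ∈ OSet cs Λ) (hE : IsIdempotentElem E) :
    r * E ∈ OSet cs Λ := by
  obtain ⟨e, he, a, ha, c, hc, rfl⟩ := h.mem_OSet_iff.mp hr
  have hcE := isIdempotentElem_conj hE c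
  have hei := h.idem e he
  have hle : IdemLE (e * ((c : R) * E * ((c⁻¹ : Rˣ) : R))) e := by
    constructor
    · rw [mul_assoc, ← h.comm hei hcE, ← mul_assoc, hei.eq]
    · rw [← mul_assoc, hei.eq]
  obtain ⟨u, hu, f, hf, hfe, hF⟩ := h.exists_conj_of_le he (h.isIdempotentElem_mul hei hcE) hle
  -- Only the part `b` in `W_{λ^*(f)}` is removed from `u`. It centralizes `f`, and monotonicity of
  -- `λ^*` keeps it inside `W_{λ(e)}`, so `u'` stays there as well.
  obtain ⟨b, hb, u', hu', rfl⟩ := exists_mul_mem_leftMin (cs := cs) (upperType cs f) u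
  have hsub : upperType cs f ⊆ typeMap cs e :=
    (h.upperType_mono f hf e he hfe).trans (upperType_subset_typeMap e)
  have hu'e : u' ∈ parabolic cs (typeMap cs e) := by
    simpa using Subgroup.mul_mem _ (inv_mem (parabolic_mono hsub hb)) hu
  -- Lengths add in `W_{λ(e)} · c`, so minimality of `u'` passes to `u' * c`. It is applied both to
  -- `c` and to `a⁻¹`.
  have hmin : ∀ c : Rˣ, c ∈ leftMin cs (typeMap cs e) → u' * c ∈ leftMin cs (upperType cs f) := by
    intro c hc
    refine mem_leftMin_iff.mpr fun i hi => ?_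
    rw [← mul_assoc, length_mul_of_mem_leftMin hc hu'e, length_mul_of_mem_leftMin hc
      (Subgroup.mul_mem _ (simple_mem_parabolic (hsub hi)) hu'e)]
    have := mem_leftMin_iff.mp hu' i hi
    omega
  have hbf : ((b⁻¹ : Rˣ) : R) * f * b = f := by
    simpa using h.conj_of_mem hf (inv_mem (parabolic_mono (upperType_subset_typeMap f) hb))
  have hF' : e * ((c : R) * E * ((c⁻¹ : Rˣ) : R)) = ((u'⁻¹ : Rˣ) : R) * f * u' := by
    rw [hF]
    nth_rw 2 [← hbf]
    simp only [mul_inv_rev, Units.val_mul, mul_assoc]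
  have heq : (a : R) * e * c * E = ((a * u'⁻¹ : Rˣ) : R) * f * ((u' * c : Rˣ) : R) :=
    calc (a : R) * e * c * E = a * (e * ((c : R) * E * ((c⁻¹ : Rˣ) : R))) * c := by
          simp only [mul_assoc, Units.inv_mul, mul_one]
      _ = _ := by
          rw [hF']
          simp only [Units.val_mul, mul_assoc]
  rw [heq]
  refine h.mem_OSet_of_leftMin_upperType hf ?_ (hmin c hc)
  rw [mul_inv_rev, inv_inv]
  exact hmin _ ha

theorem mul_mem_OSet {r s : R} (hr : r ∈ OSet cs Λ) (hs : s ∈ OSet cs Λ) :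
    r * s ∈ OSet cs Λ := by
  set hI := h.factorizable.isInverseMonoid with hIdef
  have hc := h.factorizable.idem_comm
  have i1 := isIdempotentElem_invStar_mul hI r
  have i2 := isIdempotentElem_mul_invStar hI s
  -- Cutting both factors down by `G` gives `rG` and `Gs`, with `(rG)*(rG) = G = (Gs)(Gs)*`. Their
  -- forms are then `a e c` and `c⁻¹ e d`, and the product is `a e d`.
  set G := (invStar hI r * r) * (s * invStar hI s) with hG
  have hGi : IsIdempotentElem G := h.isIdempotentElem_mul i1 i2
  have hrG : r * G ∈ OSet cs Λ := h.mul_idempotent_mem_OSet hr hGi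
  have hGs : G * s ∈ OSet cs Λ := by
    have := h.invStar_mem_OSet (h.mul_idempotent_mem_OSet (h.invStar_mem_OSet hs) hGi)
    rwa [invStar_mul _ hc, invStar_invStar, invStar_of_isIdempotentElem _ hGi] at this
  have hprod : r * s = (r * G) * (G * s) := by
    calc r * s = (r * (invStar hI r * r)) * (s * invStar hI s * s) := by
          rw [mul_invStar_mul, mul_invStar_mul_self]
      _ = r * G * s := by rw [hG]; simp only [mul_assoc]
      _ = r * (G * G) * s := by rw [hGi.eq]
      _ = _ := by simp only [mul_assoc]
  have hl : invStar hI (r * G) * (r * G) = G := by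
    rw [invStar_mul _ hc, invStar_of_isIdempotentElem _ hGi, mul_assoc, ← mul_assoc _ r,
      ← mul_assoc, h.comm hGi i1, mul_assoc, hGi.eq, hG, ← mul_assoc, i1.eq]
  have hr' : (G * s) * invStar hI (G * s) = G := by
    rw [invStar_mul _ hc, invStar_of_isIdempotentElem _ hGi, mul_assoc, ← mul_assoc s,
      ← h.comm hGi i2, ← mul_assoc, hGi.eq, hG, mul_assoc, i2.eq]
  obtain ⟨e, he, a, ha, c, hc', h1⟩ := h.mem_OSet_iff.mp hrG
  obtain ⟨f, hf, b, hb, d, hd, h2⟩ := h.mem_OSet_iff.mp hGs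
  rw [h1, h.invStar_mul_self he] at hl
  rw [h2, h.self_mul_invStar hf] at hr'
  obtain ⟨rfl, rfl⟩ := h.conj_eq_conj he hf hc' hb (by rw [inv_inv, hl, hr'])
  rw [hprod, h1, h2]
  refine h.mem_OSet_iff.mpr ⟨e, he, a, ha, d, hd, ?_⟩
  simp only [mul_assoc, Units.inv_mul_cancel_left]
  rw [← mul_assoc e e, (h.idem e he).eq]

/-- For `r = a e c` one has `r r* = a e a⁻¹`. By uniqueness in `conj_eq_conj` this lies in `Λ` only
when `a = 1`. -/
theorem mem_GJ_iff_mem_OSet {r : R} : r ∈ GJ cs Λ ↔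
    r ∈ OSet cs Λ ∧ r * invStar h.factorizable.isInverseMonoid r ∈ Λ := by
  constructor
  · intro hr
    refine ⟨h.GJ_subset_OSet hr, ?_⟩
    obtain ⟨e, he, y, hy, rfl⟩ := mem_GJ_iff.mp hr
    have := h.self_mul_invStar (x := 1) (y := y) he
    simp only [Units.val_one, one_mul, inv_one, mul_one] at this
    rwa [this]
  · rintro ⟨hr, hΛ⟩
    obtain ⟨e, he, a, ha, c, hc, rfl⟩ := h.mem_OSet_iff.mp hr
    rw [h.self_mul_invStar he] at hΛ
    obtain ⟨-, h1⟩ := h.conj_eq_conj he hΛ ha (one_mem_leftMin _) (by simp)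
    refine mem_GJ_iff.mpr ⟨e, he, c, hc, ?_⟩
    rw [inv_eq_one.mp h1]
    simp

/-- An idempotent is never strictly below one of its conjugates, even without finiteness. A
comparable pair is moved into `Λ` by a single unit, and the transversal sends both members to `f`.
-/
theorem idemLE_conj_eq {f : R} (hf : f ∈ Λ) {u : Rˣ} (hle : IdemLE f (((u⁻¹ : Rˣ) : R) * f * u)) :
    ((u⁻¹ : Rˣ) : R) * f * u = f := by
  have hi : IsIdempotentElem (((u⁻¹ : Rˣ) : R) * f * u) := by
    simpa using isIdempotentElem_conj (h.idem f hf) u⁻¹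
  obtain ⟨t, f₁, hf₁, f₂, hf₂, -, ht₁, ht₂⟩ := h.conj_pair _ _ (h.idem f hf) hi hle
  have e₁ := h.conj_eq hf hf₁ ht₁
  have e₂ : f = f₂ := by
    refine h.conj_eq hf hf₂ (w := t * u⁻¹) ?_
    rw [← ht₂]
    simp only [mul_inv_rev, inv_inv, Units.val_mul, mul_assoc]
  have h3 := (Units.mul_left_inj _).mp (ht₂.trans (e₂.symm.trans (e₁.trans ht₁.symm)))
  exact (Units.mul_right_inj _).mp h3

theorem mul_conj_mem {e f : R} (he : e ∈ Λ) (hf : f ∈ Λ) {y : Rˣ}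
    (hy : y ∈ leftMin cs (typeMap cs e)) :
    e * ((y : R) * f * ((y⁻¹ : Rˣ) : R)) ∈ Λ := by
  have hei := h.idem e he
  have hyf := isIdempotentElem_conj (h.idem f hf) y
  set E := e * ((y : R) * f * ((y⁻¹ : Rˣ) : R)) with hE
  have hEi : IsIdempotentElem E := h.isIdempotentElem_mul hei hyf
  have hle₁ : IdemLE E e := by
    constructor
    · rw [hE, mul_assoc, ← h.comm hei hyf, ← mul_assoc, hei.eq]
    · rw [hE, ← mul_assoc, hei.eq]
  have hle₂ : IdemLE E ((y : R) * f * ((y⁻¹ : Rˣ) : R)) := by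
    constructor
    · rw [hE, mul_assoc, hyf.eq]
    · rw [hE, ← mul_assoc, ← h.comm hei hyf, mul_assoc, hyf.eq]
  -- Two conjugations of `E` into `Λ` are compared: `u` centralizes `e`, while `v` also carries `y f
  -- y⁻¹` into `Λ`. The transversal identifies their targets, so `v u⁻¹` centralizes `g` and `v y`
  -- centralizes `f`.
  obtain ⟨u, hu, g, hg, hge, hEu⟩ := h.exists_conj_of_le he hEi hle₁
  obtain ⟨v, g', hg', f', hf', hgf, hv₁, hv₂⟩ := h.conj_pair _ _ hEi hyf hle₂
  have hff : ((v * y : Rˣ) : R) * f * (((v * y)⁻¹ : Rˣ) : R) = f' := by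
    rw [← hv₂]
    simp only [mul_inv_rev, Units.val_mul, mul_assoc]
  obtain rfl := h.conj_eq hf hf' hff
  have hgg : ((v * u⁻¹ : Rˣ) : R) * g * (((v * u⁻¹)⁻¹ : Rˣ) : R) = g' := by
    rw [← hv₁, hEu]
    simp only [mul_inv_rev, inv_inv, Units.val_mul, mul_assoc]
  obtain rfl := h.conj_eq hg hg' hgg
  have hq := h.mem_of_conj hf hff
  obtain ⟨d, hd, c, hc, hdc⟩ := h.exists_upper_mul_lower hg (inv_mem (h.mem_of_conj hg hgg))
  have hde : d ∈ parabolic cs (typeMap cs e) := parabolic_mono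
    ((h.upperType_mono g hg e he hge).trans (upperType_subset_typeMap e)) hd
  -- From `u v⁻¹ = d c` follows `(d⁻¹ u) y = c (v y)` with `d⁻¹ u ∈ W_{λ(e)}`. As `y` is minimal, it
  -- is a subword of the right side, hence `y = c' q'` with `c'` fixing `g` and `q'` centralizing
  -- `f`.
  obtain ⟨c', hc', q', hq', rfl⟩ := exists_mul_of_mem_leftMin hy (Subgroup.mul_mem _ (inv_mem hde) hu) hc hq
    (by rw [mul_assoc, inv_mul_eq_iff_eq_mul, ← mul_assoc d, ← hdc]; group)
  have hgE : g * E = g := by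
    have h1 : (q' : R) * f = f * q' := h.commute_of_mem hf hq'
    calc g * E = (g * e) * (c' * (q' * f) * ((((c' * q')⁻¹ : Rˣ)) : R)) := by
          rw [hE]; simp only [Units.val_mul, mul_assoc]
      _ = (g * c') * (f * q') * ((((c' * q')⁻¹ : Rˣ)) : R) := by
          rw [hge.1, h1]; simp only [mul_assoc]
      _ = (g * f) * (q' * ((((c' * q')⁻¹ : Rˣ)) : R)) := by
          rw [h.mul_of_mem_lower hg hc']; simp only [mul_assoc]
      _ = g * ((c'⁻¹ : Rˣ) : R) := by
          rw [hgf.1, mul_inv_rev, Units.val_mul, Units.mul_inv_cancel_left]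
      _ = g := h.mul_of_mem_lower hg (inv_mem hc')
  -- `E` is a conjugate of `g` lying above `g`, so the two are equal.
  have hEg : E = g := by
    rw [hEu]
    refine h.idemLE_conj_eq hg ?_
    rw [← hEu]
    exact ⟨hgE, by rw [← h.comm (h.idem g hg) hEi, hgE]⟩
  rwa [hEg]

theorem mul_mem_GJ {r s : R} (hr : r ∈ GJ cs Λ) (hs : s ∈ GJ cs Λ) : r * s ∈ GJ cs Λ := by
  rw [h.mem_GJ_iff_mem_OSet]
  refine ⟨h.mul_mem_OSet (h.GJ_subset_OSet hr) (h.GJ_subset_OSet hs), ?_⟩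
  obtain ⟨e, he, y, hy, rfl⟩ := mem_GJ_iff.mp hr
  obtain ⟨f, hf, z, hz, rfl⟩ := mem_GJ_iff.mp hs
  have hc := h.factorizable.idem_comm
  have h1 := invStar_units_mul_mul h.factorizable.isInverseMonoid (h.idem e he) 1 y
  have h2 := h.self_mul_invStar (x := 1) (y := z) hf
  simp only [Units.val_one, one_mul, inv_one, mul_one] at h1 h2
  have heq : e * y * (f * z) * invStar h.factorizable.isInverseMonoid (e * y * (f * z)) =
      e * ((y : R) * f * ((y⁻¹ : Rˣ) : R)) := by
    rw [invStar_mul _ hc, h1, mul_assoc (e * y), ← mul_assoc (f * z), h2]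
    calc e * (y : R) * (f * (((y⁻¹ : Rˣ) : R) * e))
        = e * ((y : R) * f * ((y⁻¹ : Rˣ) : R) * e) := by simp only [mul_assoc]
      _ = e * (e * ((y : R) * f * ((y⁻¹ : Rˣ) : R))) := by
          rw [h.comm (isIdempotentElem_conj (h.idem f hf) y) (h.idem e he)]
      _ = _ := by rw [← mul_assoc, (h.idem e he).eq]
  rw [heq]
  exact h.mul_conj_mem he hf hy

theorem one_mem_GJ : (1 : R) ∈ GJ cs Λ :=
  mem_GJ_iff.mpr ⟨1, h.one_mem, 1, one_mem_leftMin _, by simp⟩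

theorem mul_mem_JG {r s : R} (hr : r ∈ JG cs Λ) (hs : s ∈ JG cs Λ) : r * s ∈ JG cs Λ := by
  rw [h.mem_JG_iff, invStar_mul _ h.factorizable.idem_comm]
  exact h.mul_mem_GJ (h.invStar_mem_GJ hs) (h.invStar_mem_GJ hr)

theorem one_mem_JG : (1 : R) ∈ JG cs Λ := by
  rw [h.mem_JG_iff, invStar_of_isIdempotentElem _ IsIdempotentElem.one]
  exact h.one_mem_GJ

theorem exists_JG_mul_GJ {r : R} (hr : r ∈ OSet cs Λ) :
    ∃ p ∈ JG cs Λ, ∃ q ∈ GJ cs Λ, r = p * q := by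
  obtain ⟨e, he, a, ha, c, hc, rfl⟩ := h.mem_OSet_iff.mp hr
  refine ⟨a * e, h.mem_JG_iff.mpr ?_, e * c, mem_GJ_iff.mpr ⟨e, he, c, hc, rfl⟩, ?_⟩
  · have := invStar_units_mul_mul h.factorizable.isInverseMonoid (h.idem e he) a 1
    simp only [Units.val_one, inv_one, one_mul, mul_one] at this
    exact mem_GJ_iff.mpr ⟨e, he, a⁻¹, ha, this⟩
  · rw [← mul_assoc, mul_assoc (a : R) e e, (h.idem e he).eq]

/-! ### Minima of the Green classes -/

theorem GJ_eq : GJ cs Λ = {r | ∀ s, greenL R r s → AdhPlus cs Λ r s} := by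
  ext r
  constructor
  · rintro ⟨e, y, hr⟩ s hrs
    obtain ⟨x, f, z, hs⟩ := h.exists_leftForm s
    have hrs' := hrs
    rw [hr.2.2.2, hs.2.2.2] at hrs'
    obtain ⟨rfl, rfl⟩ := (h.greenL_form_iff hr.1 hs.1 hr.2.2.1 hs.2.2.1).mp hrs'
    have hee := (h.idem e hr.1).eq
    exact ⟨1, e, y, x, e, y, hr, hs, ⟨hee, hee⟩, 1, Subgroup.one_mem _, 1, Subgroup.one_mem _,
      BruhatLE.one_le _, by simpa using BruhatLE.refl y⟩
  · intro hr
    obtain ⟨x, e, y, hxey⟩ := h.exists_leftForm r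
    have hy := hxey.2.2.1
    have hs : IsLeftForm cs Λ (e * y) 1 e y :=
      ⟨hxey.1, mem_rightMin_iff.mpr (by simpa using one_mem_leftMin _), hy, by simp⟩
    have hL : greenL R r (e * y) := by
      rw [hxey.2.2.2, hs.2.2.2]
      exact (h.greenL_form_iff hxey.1 hxey.1 hy hy).mpr ⟨rfl, rfl⟩
    obtain ⟨x', e', y', a, f, b, h1, h2, -, u, hu, v, hv, h3, h4⟩ := hr _ hL
    obtain ⟨rfl, rfl, rfl⟩ := h.leftForm_unique hxey h1
    obtain ⟨rfl, rfl, rfl⟩ := h.leftForm_unique hs h2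
    -- Both forms have the same `e` and `y`, so `(u v)⁻¹ y ≤ y` with `u v ∈ W_{λ(e)}`. Additivity of
    -- lengths forces `u v = 1`.
    have huv := eq_one_of_mul_length_le hy (inv_mem (upper_mul_lower_mem hu hv)) h4.length_le
    rw [inv_eq_one] at huv
    have h5 := h3.length_le
    rw [huv, mul_one, cs.length_one, Nat.le_zero, cs.length_eq_zero_iff] at h5
    subst h5
    exact ⟨e, y, hxey⟩

omit h in
theorem rightMin_typeMap_subset (e : R) :
    rightMin cs (typeMap cs e) ⊆ rightMin cs (lowerType cs e) := fun _ ha => mem_rightMin_iff.mpr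
    (leftMin_anti (lowerType_subset_typeMap e) (mem_rightMin_iff.mp ha))

theorem greenR_form_iff {e : R} (he : e ∈ Λ) {x a y z : Rˣ} :
    greenR R (x * e * y) (a * e * z) ↔ a⁻¹ * x ∈ parabolic cs (typeMap cs e) := by
  rw [greenR_iff h.factorizable.isInverseMonoid h.factorizable.idem_comm, h.self_mul_invStar he,
    h.self_mul_invStar he, h.mem_parabolic_typeMap he, Units.val_mul]
  constructor
  · intro hxa
    have h1 : (x : R) * e = a * e * ((a⁻¹ : Rˣ) : R) * x := by
      rw [← hxa, mul_assoc _ _ (x : R), Units.inv_mul, mul_one]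
    rw [mul_assoc, h1]
    simp only [mul_assoc, Units.inv_mul_cancel_left]
  · intro hxa
    have h1 : (x : R) * e = a * (e * (((a⁻¹ : Rˣ) : R) * x)) := by
      rw [← hxa]
      simp only [mul_assoc, Units.mul_inv_cancel_left]
    rw [h1]
    simp only [mul_assoc, Units.mul_inv, mul_one]

theorem OSet_eq_plus : OSet cs Λ = {r | ∀ s, greenH R r s → AdhPlus cs Λ r s} := by
  ext r
  constructor
  · intro hr s hrs
    obtain ⟨e, he, a, ha, y, hy, rfl⟩ := h.mem_OSet_iff.mp hr
    have hrf : IsLeftForm cs Λ (a * e * y) a e y :=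
      ⟨he, rightMin_typeMap_subset e (mem_rightMin_iff.mpr ha), hy, rfl⟩
    obtain ⟨x, f, z, hs⟩ := h.exists_leftForm s
    obtain ⟨hL, hR⟩ := hrs
    have hse := hs.2.2.2
    rw [hse] at hL hR
    obtain ⟨rfl, rfl⟩ := (h.greenL_form_iff he hs.1 hy hs.2.2.1).mp hL
    have hmem := (h.greenR_form_iff he).mp hR
    have hle := (mem_leftMin_iff_bruhatLE.mp ha _ hmem).inv
    have hee := (h.idem e he).eq
    refine ⟨a, e, y, x, e, y, hrf, hs, ⟨hee, hee⟩, 1, Subgroup.one_mem _, 1, Subgroup.one_mem _,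
      ?_, by simpa using BruhatLE.refl y⟩
    simpa using hle
  · intro hr
    obtain ⟨x, e, y, hxey⟩ := h.exists_leftForm r
    have he := hxey.1
    have hy := hxey.2.2.1
    -- `a⁻¹` is the minimal element of `x W_{λ(e)}`, so `a⁻¹ e y` is the element of `OSet` in the
    -- H-class to compare with.
    obtain ⟨p, hp, a, ha, hpa⟩ := exists_mul_mem_leftMin (cs := cs) (typeMap cs e) x⁻¹
    have hs : IsLeftForm cs Λ (((a⁻¹ : Rˣ) : R) * e * y) a⁻¹ e y :=
      ⟨he, rightMin_typeMap_subset e (mem_rightMin_iff.mpr (by rwa [inv_inv])), hy, rfl⟩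
    have hH : greenH R r (((a⁻¹ : Rˣ) : R) * e * y) := by
      rw [hxey.2.2.2]
      refine ⟨(h.greenL_form_iff he he hy hy).mpr ⟨rfl, rfl⟩, (h.greenR_form_iff he).mpr ?_⟩
      rw [inv_eq_iff_eq_inv] at hpa
      rw [hpa]
      simpa using inv_mem hp
    obtain ⟨x', e', y', b, f, c, h1, h2, -, u, hu, v, hv, h3, h4⟩ := hr _ hH
    obtain ⟨rfl, rfl, rfl⟩ := h.leftForm_unique hxey h1
    obtain ⟨rfl, rfl, rfl⟩ := h.leftForm_unique hs h2
    have huv := eq_one_of_mul_length_le hy (inv_mem (upper_mul_lower_mem hu hv)) h4.length_le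
    rw [inv_eq_one] at huv
    have h5 := h3.length_le
    rw [huv, mul_one, ← cs.length_inv x, hpa, cs.length_inv] at h5
    have h6 := eq_one_of_mul_length_le ha hp h5
    rw [h6, one_mul] at hpa
    exact h.mem_OSet_iff.mpr ⟨e, he, x, by rwa [hpa], y, hy, hxey.2.2.2⟩

theorem greenL_invStar {r s : R} : greenL R r (invStar h.factorizable.isInverseMonoid s) ↔
    greenR R (invStar h.factorizable.isInverseMonoid r) s := by
  rw [greenL_iff_greenR_invStar h.factorizable.isInverseMonoid h.factorizable.idem_comm,
    invStar_invStar]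

theorem greenR_invStar {r s : R} : greenR R r (invStar h.factorizable.isInverseMonoid s) ↔
    greenL R (invStar h.factorizable.isInverseMonoid r) s := by
  rw [greenR_iff_greenL_invStar h.factorizable.isInverseMonoid h.factorizable.idem_comm,
    invStar_invStar]

theorem JG_eq : JG cs Λ = {r | ∀ s, greenR R r s → AdhMinus cs Λ r s} := by
  ext r
  rw [h.mem_JG_iff, h.GJ_eq]
  constructor
  · intro hr s hrs
    refine h.adhMinus_iff.mpr (hr _ (h.greenL_invStar.mpr ?_))
    rwa [invStar_invStar]
  · intro hr s hrs
    have := h.adhMinus_iff.mp (hr _ (h.greenR_invStar.mpr hrs))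
    rwa [invStar_invStar] at this

theorem OSet_eq_minus : OSet cs Λ = {r | ∀ s, greenH R r s → AdhMinus cs Λ r s} := by
  ext r
  have hmem : r ∈ OSet cs Λ ↔ invStar h.factorizable.isInverseMonoid r ∈ OSet cs Λ :=
    ⟨h.invStar_mem_OSet, fun hr => by simpa only [invStar_invStar] using h.invStar_mem_OSet hr⟩
  rw [hmem, h.OSet_eq_plus]
  constructor
  · rintro hr s ⟨hL, hR⟩
    refine h.adhMinus_iff.mpr (hr _ ⟨h.greenL_invStar.mpr ?_, h.greenR_invStar.mpr ?_⟩)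
    · rwa [invStar_invStar]
    · rwa [invStar_invStar]
  · rintro hr s ⟨hL, hR⟩
    have := h.adhMinus_iff.mp (hr _ ⟨h.greenL_invStar.mpr hR, h.greenR_invStar.mpr hL⟩)
    rwa [invStar_invStar] at this

/-- Passing to the minima of `L`-classes preserves the order `≤⁺`. -/
theorem adhPlus_of_mem_GJ {r s a b : R} (hrs : AdhPlus cs Λ r s) (ha : a ∈ GJ cs Λ)
    (hra : greenL R r a) (hb : b ∈ GJ cs Λ) (hsb : greenL R s b) : AdhPlus cs Λ a b := by
  obtain ⟨x, e, y, c, f, z, hr, hs, hef, u, hu, v, hv, -, hle⟩ := hrs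
  obtain ⟨e', y', ha⟩ := ha
  obtain ⟨f', z', hb⟩ := hb
  rw [hr.2.2.2, ha.2.2.2] at hra
  rw [hs.2.2.2, hb.2.2.2] at hsb
  obtain ⟨rfl, rfl⟩ := (h.greenL_form_iff hr.1 ha.1 hr.2.2.1 ha.2.2.1).mp hra
  obtain ⟨rfl, rfl⟩ := (h.greenL_form_iff hs.1 hb.1 hs.2.2.1 hb.2.2.1).mp hsb
  exact ⟨1, e, y, 1, f, z, ha, hb, hef, u, hu, v, hv, BruhatLE.one_le _, hle⟩

theorem exists_mem_GJ_greenL (r : R) : ∃ a ∈ GJ cs Λ, greenL R a r := by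
  obtain ⟨x, e, he, y, hy, rfl⟩ := h.exists_unit_mul_unit r
  refine ⟨e * y, mem_GJ_iff.mpr ⟨e, he, y, hy, rfl⟩, ?_⟩
  have := (h.greenL_form_iff (x := 1) (a := x) he he hy hy).mpr ⟨rfl, rfl⟩
  simpa using this

theorem eq_of_mem_GJ {a b : R} (ha : a ∈ GJ cs Λ) (hb : b ∈ GJ cs Λ) (hab : greenL R a b) :
    a = b := by
  obtain ⟨e, y, ha⟩ := ha
  obtain ⟨f, z, hb⟩ := hb
  rw [ha.2.2.2, hb.2.2.2] at hab ⊢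
  obtain ⟨rfl, rfl⟩ := (h.greenL_form_iff ha.1 hb.1 ha.2.2.1 hb.2.2.1).mp hab
  rfl

theorem exists_mem_OSet_greenH (r : R) : ∃ a ∈ OSet cs Λ, greenH R a r := by
  obtain ⟨x, e, he, y, hy, rfl⟩ := h.exists_unit_mul_unit r
  obtain ⟨p, hp, a, ha, hpa⟩ := exists_mul_mem_leftMin (cs := cs) (typeMap cs e) x⁻¹
  refine ⟨((a⁻¹ : Rˣ) : R) * e * y, h.mem_OSet_iff.mpr ⟨e, he, a⁻¹, by rwa [inv_inv], y, hy, rfl⟩,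
    (h.greenL_form_iff he he hy hy).mpr ⟨rfl, rfl⟩, (h.greenR_form_iff he).mpr ?_⟩
  rw [hpa]
  simpa using hp

theorem eq_of_mem_OSet {a b : R} (ha : a ∈ OSet cs Λ) (hb : b ∈ OSet cs Λ) (hab : greenH R a b) :
    a = b := by
  obtain ⟨e, he, x, hx, y, hy, rfl⟩ := h.mem_OSet_iff.mp ha
  obtain ⟨f, hf, x', hx', y', hy', rfl⟩ := h.mem_OSet_iff.mp hb
  obtain ⟨hL, hR⟩ := hab
  obtain ⟨rfl, rfl⟩ := (h.greenL_form_iff he hf hy hy').mp hL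
  have h1 := (h.greenR_form_iff he).mp hR
  have h2 := eq_of_mem_leftMin hx' hx (by rwa [inv_inv])
  rw [inv_injective h2]

end IsSystem

/-! ### Bijections onto quotients, inverse submonoids, and the final assembly. -/

theorem bijective_quotient_mk {X : Type*} {A : Set X} {S : Setoid X}
    (hex : ∀ r, ∃ a ∈ A, S a r) (huniq : ∀ a ∈ A, ∀ b ∈ A, S a b → a = b) :
    Function.Bijective (fun r : A => Quotient.mk S (r : X)) := by
  constructor
  · rintro ⟨a, ha⟩ ⟨b, hb⟩ hab
    exact Subtype.ext (huniq a ha b hb (Quotient.exact hab))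
  · intro q
    induction q using Quotient.inductionOn with
    | h r =>
      obtain ⟨a, ha, har⟩ := hex r
      exact ⟨⟨a, ha⟩, Quotient.sound har⟩

theorem isInverseMonoid_submonoid {h : IsInverseMonoid R} {N : Submonoid R}
    (hN : ∀ r ∈ N, invStar h r ∈ N) : IsInverseMonoid N := by
  intro r
  have hr := isInverseOf_invStar h (r : R)
  refine ⟨⟨invStar h r, hN r r.2⟩, ⟨Subtype.ext hr.1, Subtype.ext hr.2⟩, fun n hn => ?_⟩
  exact Subtype.ext (eq_invStar h
    ⟨congrArg Subtype.val hn.1, congrArg Subtype.val hn.2⟩)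

/-- An inverse taken inside `N` is also an inverse in the ambient monoid, where it is unique. Hence
a submonoid that is an inverse monoid in its own right is closed under the involution. -/
theorem invStar_mem_of_isInverseMonoid (h : IsInverseMonoid R) {N : Submonoid R}
    (hN : IsInverseMonoid N) {r : R} (hr : r ∈ N) : invStar h r ∈ N := by
  obtain ⟨n, hn, -⟩ := hN ⟨r, hr⟩
  rw [← eq_invStar h (n := (n : R)) ⟨congrArg Subtype.val hn.1, congrArg Subtype.val hn.2⟩]
  exact n.2

end GeneralizedRennerCoxeterSystems
end RennerCoxeter

open RennerCoxeter in
theorem mainTheorem5 {R : Type*} [Monoid R] {B : Type*} {M : CoxeterMatrix B}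
    (cs : CoxeterSystem M Rˣ) (Λ : Set R) (h : IsSystem cs Λ) :
    -- descriptions as sets of minima of Green classes
    (GJ cs Λ = {r | ∀ s, greenL R r s → AdhPlus cs Λ r s} ∧
      JG cs Λ = {r | ∀ s, greenR R r s → AdhMinus cs Λ r s} ∧
      OSet cs Λ = {r | ∀ s, greenH R r s → AdhPlus cs Λ r s} ∧
      OSet cs Λ = {r | ∀ s, greenH R r s → AdhMinus cs Λ r s}) ∧
    -- behaviour under the involution
    (invStar h.factorizable.isInverseMonoid '' GJ cs Λ = JG cs Λ ∧
      invStar h.factorizable.isInverseMonoid '' OSet cs Λ = OSet cs Λ) ∧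
    -- the three sets are monoids, and minimality of the third
    (∃ gj jg o : Submonoid R,
      (gj : Set R) = GJ cs Λ ∧ (jg : Set R) = JG cs Λ ∧ (o : Set R) = OSet cs Λ ∧
      IsLeast {N : Submonoid R | GJ cs Λ ⊆ N ∧ JG cs Λ ⊆ N} o ∧
      IsLeast {N : Submonoid R | IsInverseMonoid N ∧ GJ cs Λ ⊆ N} o ∧
      IsLeast {N : Submonoid R | IsInverseMonoid N ∧ JG cs Λ ⊆ N} o) ∧
    -- idempotents
    {e : R | IsIdempotentElem e} ⊆ OSet cs Λ ∧
    -- passing to minima preserves the orders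
    (∀ r s, AdhPlus cs Λ r s → ∀ a ∈ GJ cs Λ, greenL R r a →
      ∀ b ∈ GJ cs Λ, greenL R s b → AdhPlus cs Λ a b) ∧
    (∀ r s, AdhMinus cs Λ r s → ∀ a ∈ JG cs Λ, greenR R r a →
      ∀ b ∈ JG cs Λ, greenR R s b → AdhMinus cs Λ a b) ∧
    -- the canonical maps to the quotients are bijections
    Function.Bijective (fun r : GJ cs Λ => (Quotient.mk (greenL R) (r : R))) ∧
    Function.Bijective (fun r : JG cs Λ => (Quotient.mk (greenR R) (r : R))) ∧
    Function.Bijective (fun r : OSet cs Λ => (Quotient.mk (greenH R) (r : R))) := by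
  set hI := h.factorizable.isInverseMonoid
  refine ⟨⟨h.GJ_eq, h.JG_eq, h.OSet_eq_plus, h.OSet_eq_minus⟩,
    ⟨invStar_image_eq hI (fun _ => h.invStar_mem_JG) (fun _ => h.invStar_mem_GJ),
      invStar_image_eq hI (fun _ => h.invStar_mem_OSet) (fun _ => h.invStar_mem_OSet)⟩,
    ⟨⟨⟨GJ cs Λ, h.mul_mem_GJ⟩, h.one_mem_GJ⟩, ⟨⟨JG cs Λ, h.mul_mem_JG⟩, h.one_mem_JG⟩,
      ⟨⟨OSet cs Λ, h.mul_mem_OSet⟩, h.GJ_subset_OSet h.one_mem_GJ⟩, rfl, rfl, rfl,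
      ⟨⟨h.GJ_subset_OSet, h.JG_subset_OSet⟩, ?_⟩,
      ⟨⟨isInverseMonoid_submonoid (h := hI) fun _ => h.invStar_mem_OSet, h.GJ_subset_OSet⟩, ?_⟩,
      ⟨⟨isInverseMonoid_submonoid (h := hI) fun _ => h.invStar_mem_OSet, h.JG_subset_OSet⟩, ?_⟩⟩,
    fun _ => h.idempotent_mem_OSet,
    fun r s hrs a ha hra b hb hsb => h.adhPlus_of_mem_GJ hrs ha hra hb hsb, ?_,
    bijective_quotient_mk h.exists_mem_GJ_greenL fun _ ha _ hb => h.eq_of_mem_GJ ha hb,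
    bijective_quotient_mk ?_ ?_,
    bijective_quotient_mk h.exists_mem_OSet_greenH fun _ ha _ hb => h.eq_of_mem_OSet ha hb⟩
  · rintro N ⟨h1, h2⟩ r hr
    obtain ⟨p, hp, q, hq, rfl⟩ := h.exists_JG_mul_GJ hr
    exact N.mul_mem (h2 hp) (h1 hq)
  · rintro N ⟨hN, h1⟩ r hr
    obtain ⟨p, hp, q, hq, rfl⟩ := h.exists_JG_mul_GJ hr
    refine N.mul_mem ?_ (h1 hq)
    rw [← invStar_invStar hI p]
    exact invStar_mem_of_isInverseMonoid hI hN (h1 (h.invStar_mem_GJ hp))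
  · rintro N ⟨hN, h1⟩ r hr
    obtain ⟨p, hp, q, hq, rfl⟩ := h.exists_JG_mul_GJ hr
    refine N.mul_mem (h1 hp) ?_
    rw [← invStar_invStar hI q]
    exact invStar_mem_of_isInverseMonoid hI hN (h1 (h.invStar_mem_JG hq))
  · intro r s hrs a ha hra b hb hsb
    rw [greenR_iff_greenL_invStar hI h.factorizable.idem_comm] at hra hsb
    exact h.adhMinus_iff.mpr (h.adhPlus_of_mem_GJ (h.adhPlus_invStar hrs) (h.invStar_mem_GJ ha) hra
      (h.invStar_mem_GJ hb) hsb)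
  · intro r
    obtain ⟨a, ha, har⟩ := h.exists_mem_GJ_greenL (invStar hI r)
    exact ⟨_, h.invStar_mem_JG ha, h.greenL_invStar.mp har⟩
  · intro a ha b hb hab
    rw [greenR_iff_greenL_invStar hI h.factorizable.idem_comm] at hab
    have := congrArg (invStar hI) (h.eq_of_mem_GJ (h.invStar_mem_GJ ha) (h.invStar_mem_GJ hb) hab)
    rwa [invStar_invStar, invStar_invStar] at this
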